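/- All graphs are finite and simple. Write $P_m$ for the path on $m$ vertices, $F_m$ for the fan (the path $P_m$ together with one additional vertex adjacent to every vertex of the path), and $\boxtimes$ for the strong product. For $m\ge 1$ and a graph $G$, let $\widehat{m\,G}$ be the graph obtained from $m$ pairwise disjoint copies of $G$ by adding one vertex adjacent to all vertices of all copies. A $c$-colouring of a graph is any assignment of one of $c$ colours to each vertex (adjacent vertices may receive the same colour), and its clustering is the maximum number of vertices in a connected component of the subgraph induced by the vertices of one colour. For integers $n\ge 1$ and $k\geq 3$, let $G_2:=\widehat{n^2\,F_{n^4}}$ and $G_{j}:=\widehat{(k-1)\,G_{j-1}}$ for $j\ge 3$ (so $G_j=G_j(n,k)$). Then the following hold. (1) For every integer $c\geq 3$ there is a constant $\varepsilon>0$, depending only on $c$, such that for every $N$ there are integers $n\ge N$ and $k\ge 3$ with $2k<n^3$ such that the graph $H:=G_{c-1}(n,k)$ has at least $N$ vertices and treewidth exactly $c$, and every $c$-colouring of $H\boxtimes P_n$ has clustering at least $$\varepsilon\,|V(H\boxtimes P_n)|^{1/(c-\frac23)}.$$ In particular, there are infinitely many graphs $H$ of treewidth $c$ and paths $P$ such that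 every $c$-colouring of $H\boxtimes P$ has clustering $\Omega(|V(H\boxtimes P)|^{1/(c-\frac23)})$. (2) There is an integer $n_0$ such that for every integer $n\ge n_0$, all integers $k,c\geq 3$ with $2k<n^3$, and $\delta<\tfrac12$ defined by $k=\delta n^3$, the graph $G_{c-1}=G_{c-1}(n,k)$ has treewidth exactly $c$, and every $c$-colouring of $G_{c-1}\boxtimes P_n$ has clustering at least $$\delta^{\frac{7}{3c-2}}\,|V(G_{c-1}\boxtimes P_n)|^{1/(c-\frac23)}.$$ -/

import Mathlib

/-- The strong product of two graphs. -/
def strongProduct {V W : Type*} (G : SimpleGraph V) (H : SimpleGraph W) :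
    SimpleGraph (V × W) where
  Adj p q := (p.1 = q.1 ∧ H.Adj p.2 q.2) ∨ (p.2 = q.2 ∧ G.Adj p.1 q.1) ∨
    (G.Adj p.1 q.1 ∧ H.Adj p.2 q.2)
  symm := ⟨by
    rintro p q (⟨h, h'⟩ | ⟨h, h'⟩ | ⟨h, h'⟩)
    · exact Or.inl ⟨h.symm, h'.symm⟩
    · exact Or.inr (Or.inl ⟨h.symm, h'.symm⟩)
    · exact Or.inr (Or.inr ⟨h.symm, h'.symm⟩)⟩
  loopless := ⟨by
    rintro p (⟨_, h⟩ | ⟨_, h⟩ | ⟨h, _⟩)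
    · exact H.loopless.irrefl _ h
    · exact G.loopless.irrefl _ h
    · exact G.loopless.irrefl _ h⟩

/-- The graph consisting of `m` pairwise disjoint copies of `G` and one further vertex `none`,
adjacent to every vertex of every copy; `some (i, v)` is the vertex `v` of the `i`-th copy. -/
def coneGraph {V : Type*} (m : ℕ) (G : SimpleGraph V) : SimpleGraph (Option (Fin m × V)) where
  Adj
    | none, none => False
    | none, some _ => True
    | some _, none => True
    | some p, some q => p.1 = q.1 ∧ G.Adj p.2 q.2
  symm := ⟨by
    rintro (_ | p) (_ | q) h
    · exact h
    · trivial
    · trivial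
    · exact ⟨h.1.symm, h.2.symm⟩⟩
  loopless := ⟨by
    rintro (_ | p) h
    · exact h
    · exact G.loopless.irrefl _ h.2⟩

/-- The fan: a path on `m` vertices and one further vertex `none`, adjacent to all of them. -/
def fanGraph (m : ℕ) : SimpleGraph (Option (Fin m)) where
  Adj
    | none, none => False
    | none, some _ => True
    | some _, none => True
    | some u, some v => (SimpleGraph.pathGraph m).Adj u v
  symm := ⟨by
    rintro (_ | u) (_ | v) h
    · exact h
    · trivial
    · trivial
    · exact SimpleGraph.Adj.symm h⟩
  loopless := ⟨by
    rintro (_ | u) h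
    · exact h
    · exact (SimpleGraph.pathGraph m).loopless.irrefl _ h⟩

/-- The vertex type of `iteratedCone n k j`. -/
def IteratedConeVertex (n k : ℕ) : ℕ → Type
  | 0 => Option (Fin (n ^ 2) × Option (Fin (n ^ 4)))
  | j + 1 => Option (Fin (k - 1) × IteratedConeVertex n k j)

instance IteratedConeVertex.instFintype (n k : ℕ) : (j : ℕ) → Fintype (IteratedConeVertex n k j)
  | 0 => inferInstanceAs (Fintype (Option (Fin (n ^ 2) × Option (Fin (n ^ 4)))))
  | j + 1 =>
    letI := IteratedConeVertex.instFintype n k j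
    inferInstanceAs (Fintype (Option (Fin (k - 1) × IteratedConeVertex n k j)))

/-- For `j = 0`, the cone over `n ^ 2` disjoint copies of the fan with base path on `n ^ 4`
vertices; for `j + 1`, the cone over `k - 1` disjoint copies of `iteratedCone n k j`. -/
def iteratedCone (n k : ℕ) : (j : ℕ) → SimpleGraph (IteratedConeVertex n k j)
  | 0 => coneGraph (n ^ 2) (fanGraph (n ^ 4))
  | j + 1 => coneGraph (k - 1) (iteratedCone n k j)

/-- A tree-decomposition of `G` indexed by the nodes of the tree `T`. -/
structure TreeDecomposition {V ι : Type*} (G : SimpleGraph V) (T : SimpleGraph ι) where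
  isTree : T.IsTree
  bag : ι → Finset V
  edge_mem : ∀ v w, G.Adj v w → ∃ x, v ∈ bag x ∧ w ∈ bag x
  connected : ∀ v, (T.induce {x | v ∈ bag x}).Connected

/-- The width: the maximum size of a bag, minus one. -/
def TreeDecomposition.width {V ι : Type*} [Fintype ι] {G : SimpleGraph V} {T : SimpleGraph ι}
    (D : TreeDecomposition G T) : ℕ :=
  (Finset.univ.sup fun x => (D.bag x).card) - 1

/-- The treewidth of a finite graph: the minimum width of a tree-decomposition. -/
noncomputable def treewidth {V : Type*} [Fintype V] (G : SimpleGraph V) : ℕ :=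
  sInf {w | ∃ (ι : Type) (_ : Fintype ι) (T : SimpleGraph ι) (D : TreeDecomposition G T),
    D.width = w}

/-- The clustering of a colouring `f` of a finite graph: the maximum number of vertices in a
connected component of the subgraph induced by the vertices of a single colour. -/
noncomputable def clustering {V α : Type*} [Fintype V] (G : SimpleGraph V) (f : V → α) : ℕ :=
  sSup {m | ∃ (a : α) (C : (G.induce {v | f v = a}).ConnectedComponent), C.supp.ncard = m}

/-!
The clustering bound is proved by contradiction: all monochromatic components are assumed to have
at most `K` vertices, where `2 * K < n ^ 3`, and `K < k` if there are at least four colours.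

*Removing cones.* Consider the column of the apex in the product of a cone with `P_n`. If it is
monochromatic, then its component, being small, misses some copy, which therefore has a colour
fewer, and induction applies. If two consecutive vertices of the column have different colours,
then their two components together have at most one vertex in some copy, so one of the two rows of
that copy avoids both colours. That row is a copy of the iterated cone with two colours fewer, where
a simpler induction, without the path, applies (`hasCluster_iteratedCone`,
`HasCluster.strongProduct_coneGraph`).

*The base case* is the cone over `n ^ 2` fans with three colours. If the apex column is not
monochromatic, two colours have fewer than `n` vertices in a row of some fan, whose path on `n ^ 4`
vertices then has a long monochromatic subpath. Otherwise one colour, say red, has fewer than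
`n / 2` vertices in the product of some fan with `P_n`, and the other two colours have to be handled
there (`hasCluster_fan_strongProduct`).

*Two colours on a fan times a path.* Label each vertex by its monochromatic component. Away from
the few columns with a red vertex every triangle carries at most two labels, so for any labels `A`
and `Y` the signed number of transitions from `A` to `Y` is a cocycle (`crossing_add`). By a discrete
Stokes argument, its value along a walk that leaves the column of the fan's apex, descends a grid
column and returns does not depend on that grid column. Three consequences follow.
* If two non-red vertices of the apex column lie in different components, then two components
  together meet every column of a long interval (`FlatStrip.exists_label_of_side_ne`), which is
  too many vertices. So all these vertices lie in one component `B`.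
* In a column without vertices of `B`, the vertices in the rows of the non-red apex vertices lie in
  a single component, or else one component meets every column of a long interval
  (`FlatStrip.label_meets_of_ne`).
* A barrier between two columns without vertices of `B` contains a vertex of `B` in each of the `n`
  rows (`FlatStrip.label_eq_of_row`).

As `B` is small, there are at most about `n ^ 2 / 2` barriers, so that some window of `n ^ 2 + n`
columns contains none; its columns without vertices of `B` then give a component with more than `K`
vertices (`not_forall_card_label_le`).

*Treewidth.* The upper bound comes from an explicit decomposition, encoded by a parent map. The
lower bound comes from a clique on `c + 1` vertices, which lies in a single bag because subtrees of a
tree have the Helly property (`SimpleGraph.IsTree.mem_of_nearest`).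
-/

/-! ### A discrete winding-number argument on labelled grids -/

/-- At most two distinct values occur among the three labels. -/
def AtMostTwo {Λ : Type*} (u v w : Λ) : Prop := u = v ∨ v = w ∨ u = w

lemma AtMostTwo.rotate {Λ : Type*} {u v w : Λ} (h : AtMostTwo u v w) : AtMostTwo v w u := by
  unfold AtMostTwo at *; tauto

open Classical in
/-- The signed number of transitions from label `A` to label `Y` along one step from `u` to `v`. -/
noncomputable def crossing {Λ : Type*} (A Y u v : Λ) : ℤ :=
  (if u = A ∧ v = Y then 1 else 0) - (if u = Y ∧ v = A then 1 else 0)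

/-- The cocycle condition: `crossing A Y` is additive around a triangle carrying at most two
labels. -/
lemma crossing_add {Λ : Type*} (A Y : Λ) {u v w : Λ} (h : AtMostTwo u v w) :
    crossing A Y u v + crossing A Y v w = crossing A Y u w := by
  classical
  unfold crossing
  rcases h with rfl | rfl | rfl
  · rw [add_eq_right, sub_eq_zero]; exact if_congr and_comm rfl rfl
  · rw [add_eq_left, sub_eq_zero]; exact if_congr and_comm rfl rfl
  · by_cases h1 : u = A <;> by_cases h2 : u = Y <;> by_cases h3 : v = A <;>
      by_cases h4 : v = Y <;> simp_all

lemma crossing_eq_zero_of_ne {Λ : Type*} {A Y u v : Λ} (hu : u ≠ Y) (hv : v ≠ Y) :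
    crossing A Y u v = 0 := by
  simp [crossing, hu, hv]

lemma crossing_eq_zero_of_ne_left {Λ : Type*} {A Y u v : Λ} (hu : u ≠ A) (hv : v ≠ A) :
    crossing A Y u v = 0 := by
  simp [crossing, hu, hv]

lemma crossing_eq_zero_of_ne_of_ne {Λ : Type*} {A Y u v : Λ} (hu : u ≠ A) (hv : u ≠ Y) :
    crossing A Y u v = 0 := by
  simp [crossing, hu, hv]

lemma crossing_eq_zero_of_ne_of_ne' {Λ : Type*} {A Y u v : Λ} (hu : v ≠ A) (hv : v ≠ Y) :
    crossing A Y u v = 0 := by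
  simp [crossing, hu, hv]

lemma crossing_self {Λ : Type*} {A Y : Λ} (h : A ≠ Y) : crossing A Y A Y = 1 := by
  simp [crossing, h]

open Classical in
/-- Summed over all target labels, the crossings count the net number of exits from `A`. -/
lemma sum_crossing {Λ : Type*} [Fintype Λ] (A u v : Λ) :
    ∑ Y, crossing A Y u v = (if u = A then 1 else 0) - (if v = A then 1 else 0) := by
  unfold crossing
  rw [Finset.sum_sub_distrib]
  congr 1
  · by_cases h : u = A <;> simp [h]
  · by_cases h : v = A <;> simp [h]

/-- The net number of transitions from `A` to `Y` down column `x`, from row `s` to row `t`. -/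
noncomputable def columnCrossing {Λ : Type*} (A Y : Λ) (L : ℕ → ℕ → Λ) (x s t : ℕ) : ℤ :=
  ∑ r ∈ Finset.Ico s t, crossing A Y (L x r) (L x (r + 1))

/-- `L x r` is the label of the cell in column `x` and row `r`, and `W s` is the label of an
additional vertex joined to row `s`. On the columns in `[a, b)` and the rows below `n`, every
elementary triangle carries at most two labels; so does every triangle formed by two consecutive
cells of row `s` and the additional vertex, for `s ∈ D`. -/
structure FlatStrip {Λ : Type*} (L : ℕ → ℕ → Λ) (W : ℕ → Λ) (D : Finset ℕ) (n a b : ℕ) :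
    Prop where
  upper : ∀ x r, a ≤ x → x + 1 < b → r + 1 < n →
    AtMostTwo (L x r) (L (x + 1) r) (L (x + 1) (r + 1))
  lower : ∀ x r, a ≤ x → x + 1 < b → r + 1 < n →
    AtMostTwo (L x r) (L x (r + 1)) (L (x + 1) (r + 1))
  side : ∀ x, a ≤ x → x + 1 < b → ∀ s ∈ D, AtMostTwo (W s) (L x s) (L (x + 1) s)
  lt : ∀ s ∈ D, s < n

namespace FlatStrip

variable {Λ : Type*} {L : ℕ → ℕ → Λ} {W : ℕ → Λ} {D : Finset ℕ} {n a b : ℕ}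

/-- Discrete Stokes theorem on the strip between two consecutive columns. -/
lemma columnCrossing_add (h : FlatStrip L W D n a b) (A Y : Λ) {x : ℕ} (hx : a ≤ x)
    (hx' : x + 1 < b) {s t : ℕ} (hst : s ≤ t) (ht : t < n) :
    columnCrossing A Y L x s t + crossing A Y (L x t) (L (x + 1) t) =
      crossing A Y (L x s) (L (x + 1) s) + columnCrossing A Y L (x + 1) s t := by
  induction t, hst using Nat.le_induction with
  | base => simp [columnCrossing]
  | succ t hst ih =>
    have ih := ih (by omega)
    have h1 := crossing_add A Y (h.upper x t hx hx' ht)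
    have h2 := crossing_add A Y (h.lower x t hx hx' ht)
    unfold columnCrossing at ih ⊢
    rw [Finset.sum_Ico_succ_top hst, Finset.sum_Ico_succ_top hst]
    linarith

/-- The net number of transitions from `A` to `Y` along the path from the side vertex at row `s`
down column `x` to the side vertex at row `t`. -/
noncomputable def loop (A Y : Λ) (L : ℕ → ℕ → Λ) (W : ℕ → Λ) (s t x : ℕ) : ℤ :=
  crossing A Y (W s) (L x s) + columnCrossing A Y L x s t + crossing A Y (L x t) (W t)

lemma loop_succ (h : FlatStrip L W D n a b) (A Y : Λ) {s t : ℕ} (hs : s ∈ D) (ht : t ∈ D)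
    (hst : s ≤ t) {x : ℕ} (hx : a ≤ x) (hx' : x + 1 < b) :
    loop A Y L W s t (x + 1) = loop A Y L W s t x := by
  have h1 := crossing_add A Y (h.side x hx hx' s hs)
  have h2 := crossing_add A Y (h.side x hx hx' t ht).rotate
  have h3 := h.columnCrossing_add A Y hx hx' hst (h.lt t ht)
  unfold loop
  linarith

lemma loop_eq (h : FlatStrip L W D n a b) (A Y : Λ) {s t : ℕ} (hs : s ∈ D) (ht : t ∈ D)
    (hst : s ≤ t) {x : ℕ} (hx : a ≤ x) (hx' : x < b) :
    loop A Y L W s t x = loop A Y L W s t a := by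
  induction x, hx using Nat.le_induction with
  | base => rfl
  | succ x hx ih => rw [h.loop_succ A Y hs ht hst hx hx', ih (by omega)]

lemma columnCrossing_eq_zero {A Y : Λ} {x s t : ℕ}
    (h : (∀ r, s ≤ r → r ≤ t → L x r ≠ A) ∨ (∀ r, s ≤ r → r ≤ t → L x r ≠ Y)) :
    columnCrossing A Y L x s t = 0 := by
  refine Finset.sum_eq_zero fun r hr => ?_
  rw [Finset.mem_Ico] at hr
  rcases h with h | h
  · exact crossing_eq_zero_of_ne_left (h r hr.1 hr.2.le) (h (r + 1) (by omega) hr.2)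
  · exact crossing_eq_zero_of_ne (h r hr.1 hr.2.le) (h (r + 1) (by omega) hr.2)

open Classical in
lemma sum_loop [Fintype Λ] (A : Λ) (s t x : ℕ) (hst : s ≤ t) :
    ∑ Y, loop A Y L W s t x = (if W s = A then 1 else 0) - (if W t = A then 1 else 0) := by
  unfold loop columnCrossing
  rw [Finset.sum_add_distrib, Finset.sum_add_distrib, Finset.sum_comm]
  simp only [sum_crossing]
  have := Finset.sum_Ico_sub (fun r => -(if L x r = A then (1 : ℤ) else 0)) hst
  simp only [neg_sub_neg] at this
  rw [this]
  ring

/-- If two side vertices carry different labels, then some pair of labels meets every column. -/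
lemma exists_label_of_side_ne [Finite Λ] (h : FlatStrip L W D n a b) {s t : ℕ} (hs : s ∈ D)
    (ht : t ∈ D) (hst : s ≤ t) (hne : W s ≠ W t) :
    ∃ Y, ∀ x, a ≤ x → x < b → ∃ r < n, L x r = W s ∨ L x r = Y := by
  classical
  have := Fintype.ofFinite Λ
  have hsum := sum_loop (L := L) (W := W) (W s) s t a hst
  rw [if_pos rfl, if_neg hne.symm] at hsum
  obtain ⟨Y, -, hY⟩ := Finset.exists_ne_zero_of_sum_ne_zero (by rw [hsum]; norm_num)
  refine ⟨Y, fun x hx hx' => ?_⟩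
  rw [← h.loop_eq (W s) Y hs ht hst hx hx'] at hY
  by_contra! hcon
  have htn := h.lt t ht
  apply hY
  unfold loop
  rw [columnCrossing_eq_zero (Or.inl fun r _ hr => (hcon r (by omega)).1),
    crossing_eq_zero_of_ne_of_ne' (hcon s (by omega)).1 (hcon s (by omega)).2,
    crossing_eq_zero_of_ne_of_ne (hcon t (by omega)).1 (hcon t (by omega)).2]
  rfl

/-- A column avoiding the common label `B` of two side vertices, but carrying different labels
next to them, forces one of its labels to meet every column. -/
lemma label_meets_of_ne (h : FlatStrip L W D n a b) {B : Λ} {s t : ℕ} (hs : s ∈ D)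
    (ht : t ∈ D) (hst : s ≤ t) (hWs : W s = B) (hWt : W t = B) {x : ℕ} (hx : a ≤ x) (hxb : x < b)
    (hclean : ∀ r < n, L x r ≠ B) (hne : L x s ≠ L x t) {x' : ℕ} (hx' : a ≤ x') (hxb' : x' < b) :
    ∃ r < n, L x' r = L x s := by
  have htn := h.lt t ht
  have h1 : loop B (L x s) L W s t x = 1 := by
    unfold loop
    rw [columnCrossing_eq_zero (Or.inl fun r _ hr => hclean r (by omega)), hWs, hWt,
      crossing_self (hclean s (by omega)).symm,
      crossing_eq_zero_of_ne hne.symm (hclean s (by omega)).symm]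
    rfl
  rw [h.loop_eq _ _ hs ht hst hx hxb, ← h.loop_eq _ _ hs ht hst hx' hxb'] at h1
  by_contra! hcon
  have hB := (hclean s (by omega)).symm
  unfold loop at h1
  rw [columnCrossing_eq_zero (Or.inr fun r _ hr => hcon r (by omega)), hWs, hWt,
    crossing_eq_zero_of_ne hB (hcon s (by omega)),
    crossing_eq_zero_of_ne (hcon t (by omega)) hB] at h1
  norm_num at h1

/-- Two columns avoiding the label `B` of a side vertex carry the same label next to it, as soon as
some row avoids `B` between them. -/
lemma label_eq_of_row (h : FlatStrip L W D n a b) {B : Λ} {s r : ℕ} (hs : s ∈ D)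
    (hWs : W s = B) (hr : r < n) {x x' : ℕ} (hx : a ≤ x) (hxx : x ≤ x') (hx' : x' < b)
    (hcl : ∀ r < n, L x r ≠ B) (hcl' : ∀ r < n, L x' r ≠ B)
    (hrow : ∀ y, x ≤ y → y ≤ x' → L y r ≠ B) : L x s = L x' s := by
  by_contra hne
  have hsn := h.lt s hs
  have hself := crossing_self (hcl s hsn).symm
  have hzero : crossing B (L x s) B (L x' s) = 0 :=
    crossing_eq_zero_of_ne (hcl s hsn).symm (Ne.symm hne)
  have hzero' : crossing B (L x s) (L x' s) B = 0 :=
    crossing_eq_zero_of_ne (Ne.symm hne) (hcl s hsn).symm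
  have hself' : crossing B (L x s) (L x s) B = -1 := by
    have := (hcl s hsn)
    simp [crossing, this]
  rcases le_total s r with hsr | hrs
  · have key : ∀ y, x ≤ y → y ≤ x' →
        crossing B (L x s) (W s) (L y s) + columnCrossing B (L x s) L y s r =
        crossing B (L x s) (W s) (L x s) + columnCrossing B (L x s) L x s r := by
      intro y hxy
      induction y, hxy using Nat.le_induction with
      | base => intro _; rfl
      | succ y hxy ih =>
        intro hy
        rw [← ih (by omega)]
        have h1 := crossing_add B (L x s) (h.side y (by omega) (by omega) s hs)
        have h2 := h.columnCrossing_add B (L x s) (x := y) (by omega) (by omega) hsr hr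
        rw [crossing_eq_zero_of_ne_left (hrow y hxy (by omega)) (hrow (y + 1) (by omega) hy)] at h2
        linarith
    have := key x' hxx le_rfl
    rw [columnCrossing_eq_zero (Or.inl fun r _ _ => hcl' r (by omega)),
      columnCrossing_eq_zero (Or.inl fun r _ _ => hcl r (by omega)), hWs, hself, hzero] at this
    norm_num at this
  · have key : ∀ y, x ≤ y → y ≤ x' →
        columnCrossing B (L x s) L y r s + crossing B (L x s) (L y s) (W s) =
        columnCrossing B (L x s) L x r s + crossing B (L x s) (L x s) (W s) := by
      intro y hxy
      induction y, hxy using Nat.le_induction with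
      | base => intro _; rfl
      | succ y hxy ih =>
        intro hy
        rw [← ih (by omega)]
        have h1 := crossing_add B (L x s) (h.side y (by omega) (by omega) s hs).rotate
        have h2 := h.columnCrossing_add B (L x s) (x := y) (by omega) (by omega) hrs hsn
        rw [crossing_eq_zero_of_ne_left (hrow y hxy (by omega)) (hrow (y + 1) (by omega) hy)] at h2
        linarith
    have := key x' hxx le_rfl
    rw [columnCrossing_eq_zero (Or.inl fun r _ _ => hcl' r (by omega)),
      columnCrossing_eq_zero (Or.inl fun r _ _ => hcl r (by omega)), hWs, hself', hzero'] at this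
    norm_num at this

end FlatStrip

/-! ### Labelled strips without large label classes -/

open Finset in
lemma card_add_card_free_blocks (R : Finset ℕ) (l q : ℕ) :
    q ≤ #{p ∈ range q | ∀ x ∈ R, x / l ≠ p} + #R := by
  classical
  have h := card_filter_add_card_filter_not (s := range q) (fun p => ∀ x ∈ R, x / l ≠ p)
  have h2 : #{p ∈ range q | ¬ ∀ x ∈ R, x / l ≠ p} ≤ #(R.image (· / l)) := by
    refine card_le_card fun p hp => ?_
    rw [mem_filter] at hp
    push Not at hp
    obtain ⟨-, x, hx, rfl⟩ := hp
    exact mem_image_of_mem _ hx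
  have h3 : #(R.image (· / l)) ≤ #R := card_image_le
  rw [card_range] at h
  omega

/-- Fewer than `q` points miss one of the first `q` blocks of length `l`. -/
lemma exists_free_block (R : Finset ℕ) {l q : ℕ} (hl : 0 < l) (hR : R.card < q) :
    ∃ p < q, ∀ x ∈ R, ¬ (p * l ≤ x ∧ x < (p + 1) * l) := by
  have h := card_add_card_free_blocks R l q
  obtain ⟨p, hp⟩ := Finset.card_pos.1
    (show 0 < (Finset.filter (fun p => ∀ x ∈ R, x / l ≠ p) (Finset.range q)).card by omega)
  rw [Finset.mem_filter, Finset.mem_range] at hp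
  refine ⟨p, hp.1, fun x hx hxp => hp.2 x hx ?_⟩
  rw [Nat.div_eq_iff hl]
  refine ⟨hxp.1, ?_⟩
  have := hxp.2
  rw [add_mul, one_mul] at this
  omega

open Finset in
/-- If every column of an interval contains a cell satisfying `P`, then there are at least as many
such cells as columns. -/
lemma sub_le_card_of_forall_column {P : ℕ → ℕ → Prop} [∀ x r, Decidable (P x r)] {M n a b : ℕ}
    (hb : b ≤ M) (h : ∀ x, a ≤ x → x < b → ∃ r < n, P x r) :
    b - a ≤ #{p ∈ range M ×ˢ range n | P p.1 p.2} := by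
  have hsub : Ico a b ⊆ ({p ∈ range M ×ˢ range n | P p.1 p.2}).image Prod.fst := by
    intro x hx
    rw [mem_Ico] at hx
    obtain ⟨r, hr, hP⟩ := h x hx.1 hx.2
    rw [mem_image]
    exact ⟨(x, r), by simp [hP, hr]; omega, rfl⟩
  have := (card_le_card hsub).trans card_image_le
  rwa [Nat.card_Ico] at this

open Finset in
/-- Consider `q` blocks of columns, each made of `a` sub-blocks of length `l`. If `R` and the set `C`
of cells are small, some block free of `R` has a sub-block with fewer than `n` cells of `C`. -/
lemma exists_sparse_subblock (R : Finset ℕ) (C : Finset (ℕ × ℕ)) {l a q n K r : ℕ}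
    (hl : 0 < l) (ha : 0 < a) (hR : #R ≤ r) (hC : #C ≤ K) (h : K < (q - r) * a * n) :
    ∃ p < q, ∃ i < a, (∀ x ∈ R, ¬ (p * (a * l) ≤ x ∧ x < (p + 1) * (a * l))) ∧
      #{c ∈ C | c.1 / l = p * a + i} < n := by
  classical
  set S := {p ∈ range q | ∀ x ∈ R, x / (a * l) ≠ p} with hS
  have hScard := card_add_card_free_blocks R (a * l) q
  rw [← hS] at hScard
  set T := (S ×ˢ range a).image (fun p => p.1 * a + p.2) with hT
  have hTcard : #T = #S * a := by
    rw [hT, card_image_of_injOn, card_product, card_range]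
    rintro ⟨p, i⟩ hp ⟨p', i'⟩ hp' heq
    simp only [coe_product, coe_range, Set.mem_prod, Set.mem_Iio] at hp hp'
    simp only at heq
    have h1 : (p * a + i) / a = p := by
      rw [mul_comm, Nat.mul_add_div ha, Nat.div_eq_of_lt hp.2, add_zero]
    have h2 : (p' * a + i') / a = p' := by
      rw [mul_comm, Nat.mul_add_div ha, Nat.div_eq_of_lt hp'.2, add_zero]
    have : p = p' := by rw [← h1, heq, h2]
    subst this
    simpa using heq
  have hlt : #C < #T * n := by
    rw [hTcard]
    refine hC.trans_lt (h.trans_le ?_)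
    gcongr
    omega
  obtain ⟨m, hm, hcount⟩ := exists_card_fiber_lt_of_card_lt_mul (f := fun c : ℕ × ℕ => c.1 / l) hlt
  rw [hT, mem_image] at hm
  obtain ⟨⟨p, i⟩, hpi, rfl⟩ := hm
  rw [mem_product, hS, mem_filter, mem_range, mem_range] at hpi
  refine ⟨p, hpi.1.1, i, hpi.2, fun x hx hxp => hpi.1.2 x hx ?_, hcount⟩
  have hpos : 0 < a * l := Nat.mul_pos ha hl
  rw [Nat.div_eq_iff hpos]
  refine ⟨hxp.1, ?_⟩
  have := hxp.2
  rw [add_mul, one_mul] at this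
  simp only
  omega

open Finset in
/-- In a flat strip all of whose side vertices carry the label `B`, consider a window with fewer
than `n` cells labelled `B`. The columns of the window avoiding `B` are all joined to each other,
because a barrier between two of them would have a cell in each of the `n` rows. -/
lemma FlatStrip.card_mul_card_le {Λ : Type*} [DecidableEq Λ] {L : ℕ → ℕ → Λ} {W : ℕ → Λ}
    {D : Finset ℕ} {n a b M K u l : ℕ} (h : FlatStrip L W D n a b) {B : Λ} (hW : ∀ s ∈ D, W s = B)
    (hbM : b ≤ M) (hK : ∀ Y, #{p ∈ range M ×ˢ range n | L p.1 p.2 = Y} ≤ K)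
    (hab : K < b - a) (hau : a ≤ u) (hub : u + l ≤ b)
    (hsparse : #{p ∈ Ico u (u + l) ×ˢ range n | L p.1 p.2 = B} < n) :
    (l + 1 - n) * #D ≤ K := by
  set Z := {p ∈ Ico u (u + l) ×ˢ range n | L p.1 p.2 = B} with hZ
  obtain ⟨r, hr, hrZ⟩ : ∃ r ∈ range n, r ∉ Z.image Prod.snd := by
    apply exists_mem_notMem_of_card_lt_card
    rw [card_range]
    exact card_image_le.trans_lt hsparse
  rw [mem_range] at hr
  have hrow : ∀ y, u ≤ y → y < u + l → L y r ≠ B := by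
    intro y h1 h2 h3
    refine hrZ (mem_image.2 ⟨(y, r), ?_, rfl⟩)
    simp [hZ, h1, h2, h3, hr]
  set C := Ico u (u + l) \ Z.image Prod.fst with hC
  have hCmem : ∀ x ∈ C, u ≤ x ∧ x < u + l ∧ ∀ r < n, L x r ≠ B := by
    intro x hx
    rw [hC, mem_sdiff, mem_Ico] at hx
    refine ⟨hx.1.1, hx.1.2, fun r hr h3 => hx.2 (mem_image.2 ⟨(x, r), ?_, rfl⟩)⟩
    simp [hZ, hx.1.1, hx.1.2, h3, hr]
  have hCcard : l + 1 - n ≤ #C := by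
    have h1 := le_card_sdiff (Z.image Prod.fst) (Ico u (u + l))
    rw [Nat.card_Ico, ← hC] at h1
    have h2 : #(Z.image Prod.fst) ≤ #Z := card_image_le
    omega
  have hvert' : ∀ x ∈ C, ∀ s ∈ D, ∀ t ∈ D, s ≤ t → L x s = L x t := by
    intro x hx s hs t ht hst
    by_contra hne
    obtain ⟨h1, h2, h3⟩ := hCmem x hx
    have := sub_le_card_of_forall_column (P := fun x' r => L x' r = L x s) hbM
      (fun x' hx' hxb' => h.label_meets_of_ne hs ht hst (hW s hs) (hW t ht) (x := x)
        (by omega) (by omega) h3 hne hx' hxb')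
    have := hK (L x s)
    omega
  have hvert : ∀ x ∈ C, ∀ s ∈ D, ∀ t ∈ D, L x s = L x t := by
    intro x hx s hs t ht
    rcases le_total s t with hst | hst
    · exact hvert' x hx s hs t ht hst
    · exact (hvert' x hx t ht s hs hst).symm
  have hhor' : ∀ x ∈ C, ∀ x' ∈ C, ∀ s ∈ D, x ≤ x' → L x s = L x' s := by
    intro x hx x' hx' s hs hxx
    obtain ⟨h1, h2, h3⟩ := hCmem x hx
    obtain ⟨h1', h2', h3'⟩ := hCmem x' hx'
    exact h.label_eq_of_row hs (hW s hs) hr (by omega) hxx (by omega) h3 h3'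
      fun y hy hy' => hrow y (by omega) (by omega)
  have hhor : ∀ x ∈ C, ∀ x' ∈ C, ∀ s ∈ D, L x s = L x' s := by
    intro x hx x' hx' s hs
    rcases le_total x x' with hxx | hxx
    · exact hhor' x hx x' hx' s hs hxx
    · exact (hhor' x' hx' x hx s hs hxx).symm
  rcases (C ×ˢ D).eq_empty_or_nonempty with he | ⟨⟨x₀, s₀⟩, h0⟩
  · have h0 : #C * #D = 0 := by rw [← card_product, he, card_empty]
    have : (l + 1 - n) * #D ≤ #C * #D := Nat.mul_le_mul_right _ hCcard
    omega
  · rw [mem_product] at h0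
    have hsub : C ×ˢ D ⊆ {p ∈ range M ×ˢ range n | L p.1 p.2 = L x₀ s₀} := by
      rintro ⟨x, s⟩ hp
      rw [mem_product] at hp
      obtain ⟨h1, h2, -⟩ := hCmem x hp.1
      have hs := h.lt s hp.2
      rw [mem_filter, mem_product, mem_range, mem_range]
      refine ⟨⟨by simp only; omega, hs⟩, ?_⟩
      simp only
      rw [hhor x hp.1 x₀ h0.1 s hp.2, hvert x₀ h0.1 s hp.2 s₀ h0.2]
    calc (l + 1 - n) * #D ≤ #C * #D := Nat.mul_le_mul_right _ hCcard
      _ = #(C ×ˢ D) := (card_product _ _).symm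
      _ ≤ _ := card_le_card hsub
      _ ≤ K := hK _

open Finset in
/-- A labelled grid with `n ^ 4` columns and `n` rows, flat away from fewer than `n / 2` columns,
has a label class with at least `n ^ 3 / 2` cells. -/
lemma not_forall_card_label_le {Λ : Type*} [Finite Λ] [DecidableEq Λ] {L : ℕ → ℕ → Λ} {W : ℕ → Λ}
    {D R : Finset ℕ} {n K r : ℕ} (hn : 10 ≤ n) (hKn : 2 * K < n ^ 3) (hr : 2 * r < n)
    (hR : #R ≤ r) (hD : n ≤ #D + r)
    (hflat : ∀ a b, b ≤ n ^ 4 → (∀ x ∈ R, ¬ (a ≤ x ∧ x < b)) → FlatStrip L W D n a b) :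
    ¬ ∀ Y, #{p ∈ range (n ^ 4) ×ˢ range n | L p.1 p.2 = Y} ≤ K := by
  intro hK
  have hWle : ∀ s ∈ D, ∀ t ∈ D, s ≤ t → W s = W t := by
    intro s hs t ht hst
    by_contra hne
    obtain ⟨p, hp, hfree⟩ := exists_free_block R (l := n ^ 3) (q := n) (by positivity) (by omega)
    have hpn : (p + 1) * n ^ 3 ≤ n ^ 4 := by
      calc (p + 1) * n ^ 3 ≤ n * n ^ 3 := Nat.mul_le_mul_right _ hp
        _ = n ^ 4 := by ring
    obtain ⟨Y, hY⟩ := (hflat _ _ hpn hfree).exists_label_of_side_ne hs ht hst hne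
    have h1 := sub_le_card_of_forall_column (P := fun x r => L x r = W s ∨ L x r = Y) hpn hY
    rw [filter_or] at h1
    have h2 := (h1.trans (card_union_le _ _)).trans (Nat.add_le_add (hK (W s)) (hK Y))
    have h3 : (p + 1) * n ^ 3 - p * n ^ 3 = n ^ 3 := by
      rw [add_mul, one_mul, Nat.add_sub_cancel_left]
    omega
  obtain ⟨s₀, hs₀⟩ : D.Nonempty := card_pos.1 (by omega)
  have hW : ∀ s ∈ D, W s = W s₀ := by
    intro s hs
    rcases le_total s s₀ with h | h
    · exact hWle s hs s₀ hs₀ h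
    · exact (hWle s₀ hs₀ s hs h).symm
  set a := (n + 1) / 2 with ha
  set l := n ^ 2 + n with hl
  set q := 2 * n - 4 with hq
  -- `q` blocks of `a * l > K` columns fit into the grid, and sub-blocks of length `l` suffice.
  have hal : K < a * l := by
    have h1 : n ≤ 2 * a := by omega
    have h2 : n * l ≤ 2 * a * l := Nat.mul_le_mul_right _ h1
    have h3 : n * l = n ^ 3 + n ^ 2 := by rw [hl]; ring
    have h4 : 2 * a * l = 2 * (a * l) := by ring
    omega
  have hqal : q * (a * l) ≤ n ^ 4 := by
    obtain ⟨m, hm⟩ : ∃ m, n = m + 2 := ⟨n - 2, by omega⟩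
    have hq' : q = 2 * m := by omega
    have h1 : 2 * a ≤ m + 3 := by omega
    calc q * (a * l) = m * (2 * a) * l := by rw [hq']; ring
      _ ≤ m * (m + 3) * l := by gcongr
      _ ≤ n ^ 4 := by
        rw [hl, hm]
        nlinarith [sq_nonneg m]
  have hcount : K < (q - r) * a * n := by
    have h1 : 3 * n ≤ 2 * (q - r) + 8 := by omega
    have h2 : n ≤ 2 * a := by omega
    obtain ⟨m, hm⟩ : ∃ m, q - r = m := ⟨_, rfl⟩
    rw [hm] at h1 ⊢
    have h3 : 2 * n ≤ 2 * m := by omega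
    have h4 : n * n * n ≤ m * (2 * a) * n := by gcongr; omega
    nlinarith
  obtain ⟨p, hp, i, hi, hfree, hsparse⟩ := exists_sparse_subblock R
    {p ∈ range (n ^ 4) ×ˢ range n | L p.1 p.2 = W s₀} (l := l) (a := a) (q := q) (n := n)
    (by positivity) (by omega) hR (hK _) hcount
  have hpb : (p + 1) * (a * l) ≤ n ^ 4 := (Nat.mul_le_mul_right _ hp).trans hqal
  have hend : (p * a + i) * l + l ≤ (p + 1) * (a * l) := by
    calc (p * a + i) * l + l = (p * a + (i + 1)) * l := by ring
      _ ≤ (p * a + a) * l := by gcongr; omega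
      _ = _ := by ring
  have hstart : p * (a * l) ≤ (p * a + i) * l := by
    calc p * (a * l) = p * a * l := by ring
      _ ≤ _ := by gcongr; omega
  have hfin := (hflat _ _ hpb hfree).card_mul_card_le hW hpb hK (u := (p * a + i) * l) (l := l)
    (by rw [add_mul, one_mul, Nat.add_sub_cancel_left]; exact hal) hstart hend (by
      refine (card_le_card fun c hc => ?_).trans_lt hsparse
      rw [mem_filter, mem_product, mem_Ico] at hc
      rw [mem_filter, mem_filter, mem_product, mem_range]
      refine ⟨⟨⟨by omega, hc.1.2⟩, hc.2⟩, ?_⟩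
      rw [Nat.div_eq_iff (by positivity)]
      omega)
  have h1 : n ^ 2 + 1 ≤ l + 1 - n := by omega
  have h2 : (n ^ 2 + 1) * n ≤ (l + 1 - n) * (2 * #D) := by gcongr; omega
  have h3 : (n ^ 2 + 1) * n = n ^ 3 + n := by ring
  have h4 : (l + 1 - n) * (2 * #D) = 2 * ((l + 1 - n) * #D) := by ring
  omega

/-! ### Monochromatic clusters -/

/-- The spanning subgraph of the edges whose endpoints have the same colour. -/
def monoGraph {V α : Type*} (G : SimpleGraph V) (f : V → α) : SimpleGraph V where
  Adj x y := G.Adj x y ∧ f x = f y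
  symm := ⟨fun _ _ h => ⟨h.1.symm, h.2.symm⟩⟩
  loopless := ⟨fun x h => G.loopless.irrefl x h.1⟩

/-- Some monochromatic component contains at least `m` vertices. -/
def HasCluster {V α : Type*} (G : SimpleGraph V) (f : V → α) (m : ℕ) : Prop :=
  ∃ C : Finset V, m ≤ C.card ∧ ∀ x ∈ C, ∀ y ∈ C, (monoGraph G f).Reachable x y

section Cluster

variable {V W α : Type*} {G : SimpleGraph V} {H : SimpleGraph W}

lemma monoGraph_reachable_map {f : W → α} {φ : V → W}
    (hadj : ∀ x y, G.Adj x y → H.Adj (φ x) (φ y)) {x y : V}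
    (h : (monoGraph G (f ∘ φ)).Reachable x y) : (monoGraph H f).Reachable (φ x) (φ y) :=
  h.map (⟨φ, fun h => ⟨hadj _ _ h.1, h.2⟩⟩ : monoGraph G (f ∘ φ) →g monoGraph H f)

lemma HasCluster.map {f : W → α} {m : ℕ} {φ : V → W} (hφ : Function.Injective φ)
    (hadj : ∀ x y, G.Adj x y → H.Adj (φ x) (φ y)) (h : HasCluster G (f ∘ φ) m) :
    HasCluster H f m := by
  obtain ⟨C, hm, hC⟩ := h
  refine ⟨C.map ⟨φ, hφ⟩, by rwa [Finset.card_map], ?_⟩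
  simp only [Finset.mem_map, Function.Embedding.coeFn_mk]
  rintro _ ⟨x, hx, rfl⟩ _ ⟨y, hy, rfl⟩
  exact monoGraph_reachable_map hadj (hC x hx y hy)

lemma induce_reachable_of_monoGraph {f : V → α} {a : α} {x y : V}
    (h : (monoGraph G f).Reachable x y) (hx : f x = a) :
    ∃ hy : f y = a, (G.induce {v | f v = a}).Reachable ⟨x, hx⟩ ⟨y, hy⟩ := by
  obtain ⟨w⟩ := h
  induction w with
  | nil => exact ⟨hx, .rfl⟩
  | cons hadj _ ih =>
    obtain ⟨hy, hr⟩ := ih (hadj.2.symm.trans hx)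
    refine ⟨hy, .trans (SimpleGraph.Adj.reachable ?_) hr⟩
    exact hadj.1

lemma HasCluster.le_clustering [Fintype V] {f : V → α} {m : ℕ} (h : HasCluster G f m) :
    m ≤ clustering G f := by
  classical
  obtain ⟨C, hm, hC⟩ := h
  rcases C.eq_empty_or_nonempty with rfl | ⟨x, hx⟩
  · simp at hm; omega
  set K := (G.induce {v | f v = f x}).connectedComponentMk ⟨x, rfl⟩ with hK
  have hle : C.card ≤ K.supp.ncard := by
    rw [← Set.ncard_image_of_injective K.supp Subtype.val_injective, ← Set.ncard_coe_finset]
    refine Set.ncard_le_ncard (fun y hy => ?_) (Set.toFinite _)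
    obtain ⟨hy', hr⟩ := induce_reachable_of_monoGraph (hC x hx y hy) rfl
    exact ⟨⟨y, hy'⟩, (SimpleGraph.ConnectedComponent.eq.2 hr.symm), rfl⟩
  refine (hm.trans hle).trans (le_csSup ⟨Fintype.card V, ?_⟩ ⟨f x, K, rfl⟩)
  rintro _ ⟨a, K', rfl⟩
  rw [← Set.ncard_image_of_injective K'.supp Subtype.val_injective, ← Nat.card_eq_fintype_card,
    ← Set.ncard_univ]
  exact Set.ncard_le_ncard (Set.subset_univ _) (Set.toFinite _)

open Classical in
/-- The vertices of the monochromatic component of `x`. -/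
noncomputable def cluster [Fintype V] (G : SimpleGraph V) (f : V → α) (x : V) : Finset V :=
  {y | (monoGraph G f).Reachable x y}

lemma mem_cluster [Fintype V] {f : V → α} {x y : V} :
    y ∈ cluster G f x ↔ (monoGraph G f).Reachable x y := by
  simp [cluster]

lemma card_cluster_le [Fintype V] {f : V → α} {K : ℕ} (h : ¬ HasCluster G f (K + 1)) (x : V) :
    (cluster G f x).card ≤ K := by
  by_contra! hlt
  refine h ⟨cluster G f x, hlt, fun y hy z hz => ?_⟩
  rw [mem_cluster] at hy hz
  exact hy.symm.trans hz

/-- A path on which fewer than `q` vertices are exceptional, all others having the same colour,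
contains a monochromatic subpath on `l` vertices if it has `q * l` vertices. -/
lemma hasCluster_of_path {f : V → α} {M q l : ℕ} (c : Fin M → V) (hc : Function.Injective c)
    (hadj : ∀ i j : Fin M, i.val + 1 = j.val → G.Adj (c i) (c j)) (B : Finset (Fin M))
    (hl : 0 < l) (hB : B.card < q) (hq : q * l ≤ M)
    (hcol : ∀ i j, i ∉ B → j ∉ B → f (c i) = f (c j)) : HasCluster G f l := by
  classical
  obtain ⟨p, hp, hfree⟩ := exists_free_block (B.image Fin.val) hl
    (Finset.card_image_le.trans_lt hB)
  have hpl : p * l + l ≤ M := by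
    calc p * l + l = (p + 1) * l := by ring
      _ ≤ q * l := Nat.mul_le_mul_right _ hp
      _ ≤ M := hq
  have hnot : ∀ i, i < l → ∀ h : p * l + i < M, (⟨p * l + i, h⟩ : Fin M) ∉ B := by
    intro i hi h hmem
    refine hfree _ (Finset.mem_image_of_mem _ hmem) ⟨Nat.le_add_right _ _, ?_⟩
    simp only
    rw [add_mul, one_mul]
    omega
  have hreach : ∀ i, ∀ hi : i < l, (monoGraph G f).Reachable
      (c ⟨p * l, by omega⟩) (c ⟨p * l + i, by omega⟩) := by
    intro i
    induction i with
    | zero => intro _; exact .rfl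
    | succ i ih =>
      intro hi
      refine (ih (by omega)).trans (SimpleGraph.Adj.reachable ⟨hadj _ _ rfl, ?_⟩)
      exact hcol _ _ (hnot _ (by omega) _) (hnot _ hi _)
  refine ⟨Finset.univ.image fun i : Fin l => c ⟨p * l + i, by omega⟩, ?_, ?_⟩
  · rw [Finset.card_image_of_injective, Finset.card_fin]
    intro i j h
    have := hc h
    simp only [Fin.mk.injEq] at this
    ext; omega
  · simp only [Finset.mem_image, Finset.mem_univ, true_and]
    rintro _ ⟨i, rfl⟩ _ ⟨j, rfl⟩
    exact (hreach i i.2).symm.trans (hreach j j.2)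

end Cluster

/-! ### Counting over disjoint copies -/

open Finset in
lemma exists_mul_le_of_sum_le {m K : ℕ} (hm : 0 < m) (c : Fin m → ℕ) (h : ∑ i, c i ≤ K) :
    ∃ i, m * c i ≤ K := by
  by_contra! hcon
  have : NeZero m := ⟨hm.ne'⟩
  have h1 : ∑ _i : Fin m, K < ∑ i, m * c i :=
    sum_lt_sum_of_nonempty univ_nonempty fun i _ => hcon i
  rw [← mul_sum, sum_const, card_fin, smul_eq_mul] at h1
  exact absurd (Nat.mul_le_mul_left m h) (by omega)

open Finset in
/-- The parts of a finite set `C` in disjoint copies, together with a point of `C` outside all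
copies, have at most as many elements as `C`. -/
lemma sum_card_copies_add_one_le {X Y : Type*} [Fintype Y] {m : ℕ} (C : Finset X)
    (ψ : Fin m → Y → X) [∀ i, DecidablePred fun y => ψ i y ∈ C] (hψ : ∀ i y i' y', ψ i y = ψ i' y' → i = i' ∧ y = y') {z : X}
    (hz : z ∈ C) (hzψ : ∀ i y, ψ i y ≠ z) : ∑ i, #{y | ψ i y ∈ C} + 1 ≤ #C := by
  classical
  have h1 : ∑ i, #{y | ψ i y ∈ C} ≤ #(C.erase z) := by
    rw [← card_sigma]
    refine card_le_card_of_injOn (fun p => ψ p.1 p.2) ?_ ?_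
    · rintro ⟨i, y⟩ hp
      simp only [coe_sigma, Set.mem_sigma_iff, mem_coe, mem_univ, mem_filter, true_and] at hp
      exact mem_coe.2 (mem_erase.2 ⟨hzψ _ _, hp⟩)
    · rintro ⟨i, y⟩ - ⟨i', y'⟩ - h
      obtain ⟨rfl, rfl⟩ := hψ _ _ _ _ h
      rfl
  rw [card_erase_of_mem hz] at h1
  have := card_pos.2 ⟨z, hz⟩
  omega

lemma AtMostTwo.of_card_le_two {α : Type*} {S : Finset α} (hS : S.card ≤ 2) {u v w : α}
    (hu : u ∈ S) (hv : v ∈ S) (hw : w ∈ S) : AtMostTwo u v w := by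
  classical
  by_contra h
  simp only [AtMostTwo, not_or] at h
  have h3 : ({u, v, w} : Finset α).card = 3 := Finset.card_eq_three.2 ⟨u, v, w, h.1, h.2.2, h.2.1, rfl⟩
  have : ({u, v, w} : Finset α) ⊆ S := by
    intro x hx
    simp only [Finset.mem_insert, Finset.mem_singleton] at hx
    rcases hx with rfl | rfl | rfl <;> assumption
  have := Finset.card_le_card this
  omega

/-! ### Colourings of the iterated cones -/

open Finset Classical in
lemma hasCluster_cone_fan {α : Type*} {n K : ℕ} (hKn : 2 * K < n ^ 3)
    (f : Option (Fin (n ^ 2) × Option (Fin (n ^ 4))) → α) (S : Finset α) (hS : #S ≤ 2)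
    (hf : ∀ x, f x ∈ S) : HasCluster (coneGraph (n ^ 2) (fanGraph (n ^ 4))) f (K + 1) := by
  by_contra hcon
  have hn : 0 < n := Nat.pos_of_ne_zero (by rintro rfl; simp at hKn)
  set C := cluster (coneGraph (n ^ 2) (fanGraph (n ^ 4))) f none with hC
  have hCK : #C ≤ K := card_cluster_le hcon none
  have hsum := sum_card_copies_add_one_le C (fun i v => some (i, v)) (by simp) (z := none)
    (mem_cluster.2 .rfl) (by simp)
  obtain ⟨i, hi⟩ := exists_mul_le_of_sum_le (by positivity) _ ((Nat.le_succ _).trans (hsum.trans hCK))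
  set B : Finset (Fin (n ^ 4)) := {u | some (i, some u) ∈ C} with hB
  have hBle : #B ≤ #{v : Option (Fin (n ^ 4)) | some (i, v) ∈ C} := by
    refine card_le_card_of_injOn some (fun u hu => ?_) (Option.some_injective _).injOn
    simpa [hB] using hu
  have hBn : #B < n := by
    by_contra! h
    have h1 : n ^ 2 * n ≤ n ^ 2 * #{v : Option (Fin (n ^ 4)) | some (i, v) ∈ C} :=
      Nat.mul_le_mul_left _ (h.trans hBle)
    have h2 : n ^ 2 * n = n ^ 3 := by ring
    omega
  refine hcon (hasCluster_of_path (fun u => some (i, some u)) (fun u v h => by simpa using h) ?_ B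
    (q := n) (by omega) hBn ?_ ?_)
  · intro u v huv
    exact ⟨rfl, SimpleGraph.pathGraph_adj.2 (Or.inl huv)⟩
  · calc n * (K + 1) ≤ n * n ^ 3 := Nat.mul_le_mul_left _ (by omega)
      _ = n ^ 4 := by ring
  · have hmem : ∀ u, u ∉ B → f (some (i, some u)) ∈ S.erase (f none) := by
      intro u hu
      refine mem_erase.2 ⟨fun h => hu ?_, hf _⟩
      rw [hB, mem_filter]
      refine ⟨mem_univ _, mem_cluster.2 (SimpleGraph.Adj.reachable ⟨trivial, h.symm⟩)⟩
    have hcard : #(S.erase (f none)) ≤ 1 := by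
      rw [card_erase_of_mem (hf _)]; omega
    intro u v hu hv
    exact card_le_one.1 hcard _ (hmem u hu) _ (hmem v hv)

open Finset Classical in
/-- The apex spoils fewer than `m` of the `m` copies for its own colour, so one copy has a colour
fewer. -/
lemma HasCluster.coneGraph {V α : Type*} [Fintype V] {G : SimpleGraph V} {m K s : ℕ}
    (hKm : K ≤ m)
    (hG : ∀ (f : V → α) (S : Finset α), #S ≤ s → (∀ x, f x ∈ S) → HasCluster G f (K + 1))
    (f : Option (Fin m × V) → α) (S : Finset α) (hS : #S ≤ s + 1) (hf : ∀ x, f x ∈ S) :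
    HasCluster (coneGraph m G) f (K + 1) := by
  by_contra hcon
  set C := cluster (_root_.coneGraph m G) f none with hC
  have hCK : #C ≤ K := card_cluster_le hcon none
  have hsum := sum_card_copies_add_one_le C (fun i v => some (i, v)) (by simp) (z := none)
    (mem_cluster.2 .rfl) (by simp)
  obtain ⟨i, hi⟩ := exists_mul_le_of_sum_le (by omega) _
    (Nat.le_sub_one_of_lt (Nat.lt_of_succ_le (hsum.trans hCK)))
  have h0 : #{v : V | some (i, v) ∈ C} = 0 := by
    by_contra h
    have := Nat.le_mul_of_pos_right m (Nat.pos_of_ne_zero h)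
    omega
  rw [card_eq_zero, filter_eq_empty_iff] at h0
  refine hcon (HasCluster.map (G := G) (φ := fun v => some (i, v)) (fun u v h => by simpa using h)
    (fun u v h => ⟨rfl, h⟩) (hG _ (S.erase (f none)) ?_ fun v => mem_erase.2 ⟨fun h => ?_, hf _⟩))
  · rw [card_erase_of_mem (hf _)]; omega
  · exact h0 (mem_univ v) (mem_cluster.2 (SimpleGraph.Adj.reachable ⟨trivial, h.symm⟩))

/-- With one colour fewer than in the main argument, the iterated cone has large clusters without
taking the product with a path. -/
lemma hasCluster_iteratedCone {α : Type*} {n k K : ℕ} (hKn : 2 * K < n ^ 3) (j : ℕ)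
    (hKk : j = 0 ∨ K ≤ k - 1) (f : IteratedConeVertex n k j → α) (S : Finset α)
    (hS : S.card ≤ j + 2) (hf : ∀ x, f x ∈ S) : HasCluster (iteratedCone n k j) f (K + 1) := by
  induction j generalizing S with
  | zero => exact hasCluster_cone_fan hKn f S hS hf
  | succ j ih =>
    have hKk' : K ≤ k - 1 := hKk.resolve_left (by omega)
    exact HasCluster.coneGraph hKk' (fun g T hT hg => ih (Or.inr hKk') g T hT hg) f S hS hf

/-! ### Colourings of the products with a path -/

/-- The cell of the product of a fan with a path in column `x` and row `r`. -/
def fanCell (M n : ℕ) [NeZero M] [NeZero n] (x r : ℕ) : Option (Fin M) × Fin n :=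
  (some (Fin.ofNat M x), Fin.ofNat n r)

section Fan

variable {M n : ℕ} [NeZero M] [NeZero n]

lemma fanCell_inj {x r x' r' : ℕ} (hx : x < M) (hr : r < n) (hx' : x' < M) (hr' : r' < n)
    (h : fanCell M n x r = fanCell M n x' r') : x = x' ∧ r = r' := by
  simp only [fanCell, Prod.mk.injEq, Option.some.injEq, Fin.ext_iff, Fin.val_ofNat] at h
  rwa [Nat.mod_eq_of_lt hx, Nat.mod_eq_of_lt hx', Nat.mod_eq_of_lt hr, Nat.mod_eq_of_lt hr'] at h

lemma pathGraph_adj_ofNat {x : ℕ} (hx : x + 1 < M) :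
    (SimpleGraph.pathGraph M).Adj (Fin.ofNat M x) (Fin.ofNat M (x + 1)) := by
  rw [SimpleGraph.pathGraph_adj, Fin.val_ofNat, Fin.val_ofNat, Nat.mod_eq_of_lt hx,
    Nat.mod_eq_of_lt (by omega)]
  exact Or.inl rfl

/-- A triangle on which at most two colours occur meets at most two monochromatic components. -/
lemma atMostTwo_component {V α : Type*} {G : SimpleGraph V} {f : V → α} {S : Finset α}
    (hS : S.card ≤ 2) {u v w : V} (hu : f u ∈ S) (hv : f v ∈ S) (hw : f w ∈ S)
    (huv : G.Adj u v) (hvw : G.Adj v w) (huw : G.Adj u w) :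
    AtMostTwo ((monoGraph G f).connectedComponentMk u) ((monoGraph G f).connectedComponentMk v)
      ((monoGraph G f).connectedComponentMk w) := by
  rcases AtMostTwo.of_card_le_two hS hu hv hw with h | h | h
  · exact Or.inl (SimpleGraph.ConnectedComponent.eq.2 (SimpleGraph.Adj.reachable ⟨huv, h⟩))
  · exact Or.inr (Or.inl (SimpleGraph.ConnectedComponent.eq.2 (SimpleGraph.Adj.reachable ⟨hvw, h⟩)))
  · exact Or.inr (Or.inr (SimpleGraph.ConnectedComponent.eq.2 (SimpleGraph.Adj.reachable ⟨huw, h⟩)))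

end Fan

open Finset Classical in
/-- In the product of a fan with a path, three colours of which one is rare leave a large
monochromatic component. -/
lemma hasCluster_fan_strongProduct {α : Type*} {n K : ℕ} (hn : 10 ≤ n) (hKn : 2 * K < n ^ 3)
    (f : Option (Fin (n ^ 4)) × Fin n → α) (S : Finset α) (hS : #S ≤ 3) (hf : ∀ x, f x ∈ S)
    {ρ : α} (hρ : ρ ∈ S) (hrare : 2 * #{p | f p = ρ} < n) :
    HasCluster (strongProduct (fanGraph (n ^ 4)) (SimpleGraph.pathGraph n)) f (K + 1) := by
  by_contra hcon
  have : NeZero n := ⟨by omega⟩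
  have hMpos : 0 < n ^ 4 := by positivity
  have : NeZero (n ^ 4) := ⟨hMpos.ne'⟩
  set G := strongProduct (fanGraph (n ^ 4)) (SimpleGraph.pathGraph n) with hG
  let cell : ℕ → ℕ → Option (Fin (n ^ 4)) × Fin n := fanCell (n ^ 4) n
  let apex : ℕ → Option (Fin (n ^ 4)) × Fin n := fun s => (none, Fin.ofNat n s)
  set R : Finset ℕ := {x ∈ range (n ^ 4) | ∃ r < n, f (cell x r) = ρ} with hR
  set D : Finset ℕ := {s ∈ range n | f (apex s) ≠ ρ} with hD
  have hRcard : #R ≤ #{p | f p = ρ} := by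
    have : R ⊆ ({p | f p = ρ} : Finset _).image
        (fun p : Option (Fin (n ^ 4)) × Fin n => p.1.elim 0 Fin.val) := by
      intro x hx
      rw [hR, mem_filter, mem_range] at hx
      obtain ⟨hx, r, hr, h⟩ := hx
      refine mem_image.2 ⟨cell x r, by simpa using h, ?_⟩
      simp only [cell, fanCell, Option.elim, Fin.val_ofNat]
      exact Nat.mod_eq_of_lt hx
    exact (card_le_card this).trans card_image_le
  have hDcard : n ≤ #D + #{p | f p = ρ} := by
    have h1 := card_filter_add_card_filter_not (s := range n) (fun s => f (apex s) ≠ ρ)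
    rw [card_range, ← hD] at h1
    have h2 : #{s ∈ range n | ¬ f (apex s) ≠ ρ} ≤ #{p | f p = ρ} := by
      refine card_le_card_of_injOn apex (fun s hs => ?_) (fun s hs t ht hst => ?_)
      · simpa using (mem_filter.1 (mem_coe.1 hs)).2
      · have h3 := mem_range.1 (mem_filter.1 (mem_coe.1 hs)).1
        have h4 := mem_range.1 (mem_filter.1 (mem_coe.1 ht)).1
        simp only [apex, Prod.mk.injEq, true_and, Fin.ext_iff, Fin.val_ofNat] at hst
        rwa [Nat.mod_eq_of_lt h3, Nat.mod_eq_of_lt h4] at hst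
    omega
  have hScard : #(S.erase ρ) ≤ 2 := by rw [card_erase_of_mem hρ]; omega
  refine not_forall_card_label_le (Λ := (monoGraph G f).ConnectedComponent)
    (L := fun x r => (monoGraph G f).connectedComponentMk (cell x r))
    (W := fun s => (monoGraph G f).connectedComponentMk (apex s)) hn hKn hrare hRcard hDcard ?_ ?_
  · intro a b hb hfree
    have hcol : ∀ x r, a ≤ x → x < b → r < n → f (cell x r) ∈ S.erase ρ := by
      intro x r hx hxb hr
      refine mem_erase.2 ⟨fun h => hfree x ?_ ⟨hx, hxb⟩, hf _⟩
      rw [hR, mem_filter, mem_range]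
      exact ⟨by omega, r, hr, h⟩
    have hx1 : ∀ x r, x + 1 < n ^ 4 → G.Adj (cell x r) (cell (x + 1) r) := fun x r hx =>
      Or.inr (Or.inl ⟨rfl, pathGraph_adj_ofNat hx⟩)
    have hr1 : ∀ x r, r + 1 < n → G.Adj (cell x r) (cell x (r + 1)) := fun x r hr =>
      Or.inl ⟨rfl, pathGraph_adj_ofNat hr⟩
    have hd1 : ∀ x r, x + 1 < n ^ 4 → r + 1 < n → G.Adj (cell x r) (cell (x + 1) (r + 1)) :=
      fun x r hx hr => Or.inr (Or.inr ⟨pathGraph_adj_ofNat hx, pathGraph_adj_ofNat hr⟩)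
    constructor
    · intro x r hx hxb hr
      exact atMostTwo_component hScard (hcol x r hx (by omega) (by omega))
        (hcol (x + 1) r (by omega) hxb (by omega)) (hcol (x + 1) (r + 1) (by omega) hxb hr)
        (hx1 x r (by omega)) (hr1 _ r hr) (hd1 x r (by omega) hr)
    · intro x r hx hxb hr
      exact atMostTwo_component hScard (hcol x r hx (by omega) (by omega))
        (hcol x (r + 1) (by omega) (by omega) (by omega)) (hcol (x + 1) (r + 1) (by omega) hxb hr)
        (hr1 _ r hr) (hx1 x _ (by omega)) (hd1 x r (by omega) hr)
    · intro x hx hxb s hs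
      rw [hD, mem_filter, mem_range] at hs
      exact atMostTwo_component hScard (mem_erase.2 ⟨hs.2, hf _⟩)
        (hcol x s hx (by omega) hs.1) (hcol (x + 1) s (by omega) hxb hs.1)
        (Or.inr (Or.inl ⟨rfl, trivial⟩)) (hx1 x s (by omega)) (Or.inr (Or.inl ⟨rfl, trivial⟩))
    · intro s hs
      exact mem_range.1 (mem_filter.1 hs).1
  · intro Y
    by_contra! hlt
    refine hcon ⟨({p ∈ range (n ^ 4) ×ˢ range n |
      (monoGraph G f).connectedComponentMk (cell p.1 p.2) = Y}).image fun p => cell p.1 p.2, ?_, ?_⟩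
    · rw [card_image_of_injOn]
      · exact hlt
      · rintro ⟨x, r⟩ hp ⟨x', r'⟩ hp' h
        simp only [coe_filter, mem_product, mem_range, Set.mem_ofPred_eq] at hp hp'
        obtain ⟨rfl, rfl⟩ := fanCell_inj hp.1.1 hp.1.2 hp'.1.1 hp'.1.2 h
        rfl
    · intro u hu v hv
      obtain ⟨p, hp, rfl⟩ := mem_image.1 hu
      obtain ⟨p', hp', rfl⟩ := mem_image.1 hv
      exact SimpleGraph.ConnectedComponent.eq.1
        ((mem_filter.1 hp).2.trans (mem_filter.1 hp').2.symm)

section Cone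

variable {V α : Type*} {G : SimpleGraph V} {m n : ℕ}

/-- The embedding of the product of the `i`-th copy with the path. -/
def coneCopy {V : Type*} {m n : ℕ} (i : Fin m) (p : V × Fin n) : Option (Fin m × V) × Fin n :=
  (some (i, p.1), p.2)

lemma coneCopy_injective (i : Fin m) : Function.Injective (coneCopy (V := V) (n := n) i) := by
  rintro ⟨u, s⟩ ⟨v, t⟩ h
  simpa [coneCopy] using h

lemma coneCopy_inj {i i' : Fin m} {p p' : V × Fin n} (h : coneCopy i p = coneCopy i' p') :
    i = i' ∧ p = p' := by
  simp only [coneCopy, Prod.mk.injEq, Option.some.injEq] at h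
  exact ⟨h.1.1, Prod.ext h.1.2 h.2⟩

lemma coneCopy_adj (i : Fin m) (p q : V × Fin n)
    (h : (strongProduct G (SimpleGraph.pathGraph n)).Adj p q) :
    (strongProduct (coneGraph m G) (SimpleGraph.pathGraph n)).Adj (coneCopy i p)
      (coneCopy i q) := by
  rcases h with ⟨h1, h2⟩ | ⟨h1, h2⟩ | ⟨h1, h2⟩
  · exact Or.inl ⟨by simp [coneCopy, h1], h2⟩
  · exact Or.inr (Or.inl ⟨h1, rfl, h2⟩)
  · exact Or.inr (Or.inr ⟨⟨rfl, h1⟩, h2⟩)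

lemma row_adj (t : Fin n) (u v : V) (h : G.Adj u v) :
    (strongProduct G (SimpleGraph.pathGraph n)).Adj (u, t) (v, t) :=
  Or.inr (Or.inl ⟨rfl, h⟩)

lemma apex_adj (t t' : Fin n) (h : t = t' ∨ (SimpleGraph.pathGraph n).Adj t t') (i : Fin m)
    (v : V) : (strongProduct (coneGraph m G) (SimpleGraph.pathGraph n)).Adj (none, t)
      (coneCopy i (v, t')) := by
  rcases h with rfl | h
  · exact Or.inr (Or.inl ⟨rfl, trivial⟩)
  · exact Or.inr (Or.inr ⟨trivial, h⟩)

/-- Along a path, either all colours agree or two consecutive vertices differ. -/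
lemma forall_eq_or_exists_adj_ne {β : Type*} (g : Fin n → β) :
    (∀ s t, g s = g t) ∨ ∃ s t : Fin n, (SimpleGraph.pathGraph n).Adj s t ∧ g s ≠ g t := by
  by_contra! h
  obtain ⟨⟨s, t, hst⟩, h⟩ := h
  apply hst
  obtain ⟨w⟩ := SimpleGraph.pathGraph_preconnected n s t
  clear hst
  induction w with
  | nil => rfl
  | cons hadj _ ih => exact (h _ _ hadj).trans ih

variable [Fintype V]

open Finset in
lemma sum_card_copies_cluster_lt {K : ℕ}
    {f : Option (Fin m × V) × Fin n → α}
    (hcon : ¬ HasCluster (strongProduct (coneGraph m G) (SimpleGraph.pathGraph n)) f (K + 1))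
    (t : Fin n) [∀ i : Fin m, DecidablePred fun p : V × Fin n => coneCopy i p ∈
      cluster (strongProduct (coneGraph m G) (SimpleGraph.pathGraph n)) f (none, t)] :
    ∑ i, #{p | coneCopy i p ∈ cluster (strongProduct (coneGraph m G) (SimpleGraph.pathGraph n)) f
      (none, t)} + 1 ≤ K :=
  (sum_card_copies_add_one_le _ coneCopy (fun _ _ _ _ h => coneCopy_inj h)
    (mem_cluster.2 .rfl) (by simp [coneCopy])).trans (card_cluster_le hcon _)

lemma mem_cluster_of_column_eq {f : Option (Fin m × V) × Fin n → α} {a : α}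
    (hcol : ∀ t, f (none, t) = a) (t₀ : Fin n) (i : Fin m) (p : V × Fin n)
    (h : f (coneCopy i p) = a) :
    coneCopy i p ∈
      cluster (strongProduct (coneGraph m G) (SimpleGraph.pathGraph n)) f (none, t₀) := by
  rw [mem_cluster]
  have h1 : (monoGraph (strongProduct (coneGraph m G) (SimpleGraph.pathGraph n)) f).Reachable
      (none, t₀) (none, p.2) :=
    (SimpleGraph.pathGraph_preconnected n t₀ p.2).map
      (⟨fun t => (none, t), fun {s t} hst => ⟨Or.inl ⟨rfl, hst⟩, by rw [hcol, hcol]⟩⟩ :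
        SimpleGraph.pathGraph n →g
          monoGraph (strongProduct (coneGraph m G) (SimpleGraph.pathGraph n)) f)
  exact h1.trans (SimpleGraph.Adj.reachable ⟨apex_adj _ _ (Or.inl rfl) i p.1, (hcol _).trans h.symm⟩)

lemma mem_cluster_of_apex {f : Option (Fin m × V) × Fin n → α} {t t' : Fin n}
    (h : t = t' ∨ (SimpleGraph.pathGraph n).Adj t t') {i : Fin m} {v : V}
    (hf : f (coneCopy i (v, t')) = f (none, t)) :
    coneCopy i (v, t') ∈
      cluster (strongProduct (coneGraph m G) (SimpleGraph.pathGraph n)) f (none, t) :=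
  mem_cluster.2 (SimpleGraph.Adj.reachable ⟨apex_adj _ _ h i v, hf.symm⟩)

end Cone

open Finset Classical in
lemma hasCluster_cone_fan_strongProduct {α : Type*} {n K : ℕ} (hn : 10 ≤ n)
    (hKn : 2 * K < n ^ 3) (f : Option (Fin (n ^ 2) × Option (Fin (n ^ 4))) × Fin n → α)
    (S : Finset α) (hS : #S ≤ 3) (hf : ∀ x, f x ∈ S) :
    HasCluster (strongProduct (coneGraph (n ^ 2) (fanGraph (n ^ 4))) (SimpleGraph.pathGraph n)) f
      (K + 1) := by
  by_contra hcon
  have hn2 : 0 < n ^ 2 := by positivity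
  have hn3 : n ^ 2 * n = n ^ 3 := by ring
  rcases forall_eq_or_exists_adj_ne (fun t => f (none, t)) with hcol | ⟨s, t, hst, hne⟩
  · -- The column of the apex is monochromatic: its colour is rare in some fan.
    let t₀ : Fin n := ⟨0, by omega⟩
    obtain ⟨i, hi⟩ := exists_mul_le_of_sum_le hn2 _
      ((Nat.le_succ _).trans (sum_card_copies_cluster_lt hcon t₀))
    refine hcon (HasCluster.map (coneCopy_injective i) (coneCopy_adj i)
      (hasCluster_fan_strongProduct hn hKn _ S hS (fun p => hf _) (hf (none, t₀)) ?_))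
    have hle : #{p | (f ∘ coneCopy i) p = f (none, t₀)} ≤ #{p | coneCopy i p ∈ cluster
        (strongProduct (coneGraph (n ^ 2) (fanGraph (n ^ 4))) (SimpleGraph.pathGraph n)) f
          (none, t₀)} := by
      refine card_le_card fun p hp => ?_
      rw [mem_filter] at hp ⊢
      exact ⟨mem_univ _, mem_cluster_of_column_eq (fun t => hcol t t₀) t₀ i p hp.2⟩
    have h1 := Nat.mul_le_mul_left (n ^ 2) hle
    by_contra! h2
    have h3 := Nat.mul_le_mul_left (n ^ 2) h2
    rw [hn3, mul_left_comm] at h3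
    omega
  · -- Two colours are rare in a row of some fan, which leaves one colour for that row.
    have hsum := Nat.add_le_add (sum_card_copies_cluster_lt hcon s)
      (sum_card_copies_cluster_lt hcon t)
    set Cs := cluster (strongProduct (coneGraph (n ^ 2) (fanGraph (n ^ 4)))
      (SimpleGraph.pathGraph n)) f (none, s) with hCs
    set Ct := cluster (strongProduct (coneGraph (n ^ 2) (fanGraph (n ^ 4)))
      (SimpleGraph.pathGraph n)) f (none, t) with hCt
    obtain ⟨i, hi⟩ := exists_mul_le_of_sum_le hn2
      (fun i => #{p | coneCopy i p ∈ Cs} + #{p | coneCopy i p ∈ Ct}) (K := 2 * K)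
      (by rw [sum_add_distrib]; omega)
    set B : Finset (Fin (n ^ 4)) :=
      {u | coneCopy i (some u, s) ∈ Cs ∨ coneCopy i (some u, s) ∈ Ct} with hB
    have hBle : #B ≤ #{p | coneCopy i p ∈ Cs} + #{p | coneCopy i p ∈ Ct} := by
      rw [hB, filter_or]
      refine (card_union_le _ _).trans (Nat.add_le_add ?_ ?_) <;>
      · refine card_le_card_of_injOn (fun u => (some u, s)) (fun u hu => ?_)
          (fun u _ v _ h => by simpa using h)
        simpa using hu
    have hBn : #B < n := by
      by_contra! h
      have h1 := Nat.mul_le_mul_left (n ^ 2) (h.trans hBle)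
      omega
    refine hcon (hasCluster_of_path (fun u => coneCopy i (some u, s))
      (fun u v h => by simpa [coneCopy] using h) ?_ B (q := n) (by omega) hBn ?_ ?_)
    · intro u v huv
      exact coneCopy_adj i _ _ (row_adj s _ _ (SimpleGraph.pathGraph_adj.2 (Or.inl huv)))
    · calc n * (K + 1) ≤ n * n ^ 3 := Nat.mul_le_mul_left _ (by omega)
        _ = n ^ 4 := by ring
    · have hmem : ∀ u, u ∉ B → f (coneCopy i (some u, s)) ∈
          (S.erase (f (none, s))).erase (f (none, t)) := by
        intro u hu
        rw [hB, mem_filter, not_and_or, not_or] at hu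
        have hu := hu.resolve_left (by simp)
        refine mem_erase.2 ⟨fun h => hu.2 (mem_cluster_of_apex (Or.inr hst.symm) h),
          mem_erase.2 ⟨fun h => hu.1 (mem_cluster_of_apex (Or.inl rfl) h), hf _⟩⟩
      have hcard : #((S.erase (f (none, s))).erase (f (none, t))) ≤ 1 := by
        rw [card_erase_of_mem (mem_erase.2 ⟨hne.symm, hf _⟩), card_erase_of_mem (hf _)]; omega
      intro u v hu hv
      exact card_le_one.1 hcard _ (hmem u hu) _ (hmem v hv)

open Finset Classical in
/-- If the column of the apex is monochromatic, some copy misses its colour. Otherwise two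
consecutive apex vertices have different colours, and their clusters contain at most one vertex of
some copy, so that one of the two rows misses both colours in that copy. -/
lemma HasCluster.strongProduct_coneGraph {V α : Type*} [Fintype V] {G : SimpleGraph V}
    {m n K s : ℕ} (hn : 0 < n) (hKm : K ≤ m)
    (hrow : ∀ (f : V → α) (S : Finset α), #S ≤ s → (∀ x, f x ∈ S) → HasCluster G f (K + 1))
    (hG : ∀ (f : V × Fin n → α) (S : Finset α), #S ≤ s + 1 → (∀ x, f x ∈ S) →
      HasCluster (strongProduct G (SimpleGraph.pathGraph n)) f (K + 1))
    (f : Option (Fin m × V) × Fin n → α) (S : Finset α) (hS : #S ≤ s + 2) (hf : ∀ x, f x ∈ S) :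
    HasCluster (strongProduct (_root_.coneGraph m G) (SimpleGraph.pathGraph n)) f (K + 1) := by
  by_contra hcon
  have hm : 0 < m := by
    have := sum_card_copies_cluster_lt hcon ⟨0, hn⟩
    omega
  rcases forall_eq_or_exists_adj_ne (fun t => f (none, t)) with hcol | ⟨s, t, hst, hne⟩
  · let t₀ : Fin n := ⟨0, hn⟩
    have hsum := sum_card_copies_cluster_lt hcon t₀
    obtain ⟨i, hi⟩ := exists_mul_le_of_sum_le hm _
      (Nat.le_sub_one_of_lt (Nat.lt_of_succ_le hsum))
    have h0 : #{p | coneCopy i p ∈ cluster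
        (strongProduct (_root_.coneGraph m G) (SimpleGraph.pathGraph n)) f (none, t₀)} = 0 := by
      by_contra h
      have := Nat.le_mul_of_pos_right m (Nat.pos_of_ne_zero h)
      omega
    rw [card_eq_zero, filter_eq_empty_iff] at h0
    refine hcon (HasCluster.map (coneCopy_injective i) (coneCopy_adj i)
      (hG _ (S.erase (f (none, t₀))) ?_ fun p => mem_erase.2 ⟨fun h => ?_, hf _⟩))
    · rw [card_erase_of_mem (hf _)]; omega
    · exact h0 (mem_univ p) (mem_cluster_of_column_eq (fun t => hcol t t₀) t₀ i p h)
  · have hsum_s := sum_card_copies_cluster_lt hcon s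
    have hsum_t := sum_card_copies_cluster_lt hcon t
    set Cs := cluster (strongProduct (_root_.coneGraph m G) (SimpleGraph.pathGraph n)) f (none, s)
      with hCs
    set Ct := cluster (strongProduct (_root_.coneGraph m G) (SimpleGraph.pathGraph n)) f (none, t)
      with hCt
    obtain ⟨i, hi⟩ := exists_mul_le_of_sum_le hm
      (fun i => #{p | coneCopy i p ∈ Cs} + #{p | coneCopy i p ∈ Ct}) (K := 2 * (K - 1))
      (by rw [sum_add_distrib]; omega)
    have hle1 : #{p | coneCopy i p ∈ Cs} + #{p | coneCopy i p ∈ Ct} ≤ 1 := by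
      by_contra! h
      have := Nat.mul_le_mul_left m (Nat.succ_le_of_lt h)
      omega
    have hfree : ∃ r : Fin n, (s = r ∨ (SimpleGraph.pathGraph n).Adj s r) ∧
        (t = r ∨ (SimpleGraph.pathGraph n).Adj t r) ∧
        ∀ v, coneCopy i (v, r) ∉ Cs ∧ coneCopy i (v, r) ∉ Ct := by
      by_contra! h
      have hs : ∃ v, coneCopy i (v, s) ∈ Cs ∨ coneCopy i (v, s) ∈ Ct := by
        obtain ⟨v, hv⟩ := h s (Or.inl rfl) (Or.inr hst.symm)
        exact ⟨v, or_iff_not_imp_left.2 hv⟩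
      have ht : ∃ v, coneCopy i (v, t) ∈ Cs ∨ coneCopy i (v, t) ∈ Ct := by
        obtain ⟨v, hv⟩ := h t (Or.inr hst) (Or.inl rfl)
        exact ⟨v, or_iff_not_imp_left.2 hv⟩
      obtain ⟨u, hu⟩ := hs
      obtain ⟨v, hv⟩ := ht
      have hsub : ({(u, s), (v, t)} : Finset (V × Fin n)) ⊆
          ({p | coneCopy i p ∈ Cs} : Finset _) ∪ ({p | coneCopy i p ∈ Ct} : Finset _) := by
        intro p hp
        rw [mem_insert, mem_singleton] at hp
        rw [mem_union, mem_filter, mem_filter]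
        rcases hp with rfl | rfl
        · simpa using hu
        · simpa using hv
      have h2 := (card_le_card hsub).trans (card_union_le _ _)
      rw [card_pair (fun h => hst.ne (Prod.ext_iff.1 h).2)] at h2
      omega
    obtain ⟨r, hsr, htr, hr⟩ := hfree
    refine hcon (HasCluster.map (G := G) (φ := fun v => coneCopy i (v, r))
      (fun u v h => by simpa [coneCopy] using h)
      (fun u v h => coneCopy_adj i _ _ (row_adj r u v h))
      (hrow _ ((S.erase (f (none, s))).erase (f (none, t))) ?_ fun v => ?_))
    · rw [card_erase_of_mem (mem_erase.2 ⟨hne.symm, hf _⟩), card_erase_of_mem (hf _)]; omega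
    · exact mem_erase.2 ⟨fun h => (hr v).2 (mem_cluster_of_apex htr h),
        mem_erase.2 ⟨fun h => (hr v).1 (mem_cluster_of_apex hsr h), hf _⟩⟩

/-- The clustering bound: `K + 1` may be as large as about `n ^ 3 / 2` for `j = 0`, and as large as
`k` for `j > 0`. -/
lemma hasCluster_iteratedCone_strongProduct {α : Type*} {n k K : ℕ} (hn : 10 ≤ n)
    (hKn : 2 * K < n ^ 3) (j : ℕ) (hKk : j = 0 ∨ K ≤ k - 1)
    (f : IteratedConeVertex n k j × Fin n → α) (S : Finset α)
    (hS : S.card ≤ j + 3) (hf : ∀ x, f x ∈ S) :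
    HasCluster (strongProduct (iteratedCone n k j) (SimpleGraph.pathGraph n)) f (K + 1) := by
  induction j generalizing S with
  | zero => exact hasCluster_cone_fan_strongProduct hn hKn f S hS hf
  | succ j ih =>
    have hKk' : K ≤ k - 1 := hKk.resolve_left (by omega)
    exact HasCluster.strongProduct_coneGraph (s := j + 2) (by omega) hKk'
      (fun g T hT hg => hasCluster_iteratedCone hKn j (Or.inr hKk') g T hT hg)
      (fun g T hT hg => ih (Or.inr hKk') g T hT hg) f S hS hf

/-! ### Treewidth -/

section Lower

variable {V ι : Type*} {G : SimpleGraph V} {T : SimpleGraph ι}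

/-- In a tree, let `y` be a vertex of the subtree `B` nearest to `x`. Any subtree `A` containing
`x` and meeting `B` contains `y`. -/
lemma SimpleGraph.IsTree.mem_of_nearest (hT : T.IsTree) {A B : Set ι}
    (hA : (T.induce A).Connected) (hB : (T.induce B).Connected) {x y z : ι} (hxA : x ∈ A)
    (hyB : y ∈ B) (hmin : ∀ w ∈ B, T.dist x y ≤ T.dist x w) (hzA : z ∈ A) (hzB : z ∈ B) :
    y ∈ A := by
  classical
  -- A shortest path from `x` to `y`, then a path inside `B`, compared with a path inside `A`.
  obtain ⟨p, hp, hpl⟩ := hT.connected.exists_path_of_dist x y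
  obtain ⟨q, hq⟩ := (hB.preconnected ⟨y, hyB⟩ ⟨z, hzB⟩).exists_isPath
  obtain ⟨r, hr⟩ := (hA.preconnected ⟨x, hxA⟩ ⟨z, hzA⟩).exists_isPath
  let q' : T.Walk y z := q.map (SimpleGraph.Embedding.induce B).toHom
  let r' : T.Walk x z := r.map (SimpleGraph.Embedding.induce A).toHom
  have hq' : q'.IsPath := hq.map Subtype.val_injective
  have hr' : r'.IsPath := hr.map Subtype.val_injective
  have hq'B : ∀ w ∈ q'.support, w ∈ B := by
    intro w hw
    rw [show q'.support = q.support.map _ from SimpleGraph.Walk.support_map _ _] at hw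
    obtain ⟨w, -, rfl⟩ := List.mem_map.1 hw
    exact w.2
  have hr'A : ∀ w ∈ r'.support, w ∈ A := by
    intro w hw
    rw [show r'.support = r.support.map _ from SimpleGraph.Walk.support_map _ _] at hw
    obtain ⟨w, -, rfl⟩ := List.mem_map.1 hw
    exact w.2
  have hpB : ∀ w ∈ p.support, w ∈ B → w = y := by
    intro w hw hwB
    by_contra hne
    have h1 : (p.takeUntil w hw).length + (p.dropUntil w hw).length = p.length := by
      rw [← SimpleGraph.Walk.length_append, SimpleGraph.Walk.take_spec]
    have h2 := SimpleGraph.dist_le (p.takeUntil w hw)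
    have h3 : (p.dropUntil w hw).length ≠ 0 := fun h =>
      hne (SimpleGraph.Walk.eq_of_length_eq_zero h)
    have := hmin w hwB
    omega
  have hpath : (p.append q').IsPath := by
    rw [SimpleGraph.Walk.isPath_def, SimpleGraph.Walk.support_append]
    have hq'n := hq'.support_nodup
    refine List.Nodup.append hp.support_nodup hq'n.tail ?_
    intro w hwp hwq
    have hwy := hpB w hwp (hq'B w (List.mem_of_mem_tail hwq))
    rw [hwy] at hwq
    rw [← SimpleGraph.Walk.cons_tail_support] at hq'n
    exact (List.nodup_cons.1 hq'n).1 hwq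
  have heq := (hT.existsUnique_path x z).unique hpath hr'
  refine hr'A y ?_
  rw [← heq, SimpleGraph.Walk.mem_support_append_iff]
  exact Or.inl p.end_mem_support

/-- Every clique is contained in a bag. -/
lemma TreeDecomposition.exists_clique_subset_bag [Finite ι] (D : TreeDecomposition G T)
    (Q : Finset V) (hQ : ∀ u ∈ Q, ∀ v ∈ Q, u ≠ v → G.Adj u v) : ∃ x, Q ⊆ D.bag x := by
  classical
  induction Q using Finset.induction_on with
  | empty =>
    obtain ⟨x⟩ := D.isTree.connected.nonempty
    exact ⟨x, by simp⟩
  | insert v Q hv ih =>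
    obtain ⟨x, hx⟩ := ih fun u hu w hw => hQ u (Finset.mem_insert_of_mem hu) w
      (Finset.mem_insert_of_mem hw)
    obtain ⟨⟨y₀, hy₀⟩⟩ := (D.connected v).nonempty
    obtain ⟨y, hy, hmin⟩ := Set.exists_min_image {y | v ∈ D.bag y} (T.dist x) (Set.toFinite _)
      ⟨y₀, hy₀⟩
    refine ⟨y, fun u hu => ?_⟩
    rcases Finset.mem_insert.1 hu with rfl | huQ
    · exact hy
    · obtain ⟨z, hzu, hzv⟩ := D.edge_mem u v (hQ u hu v (Finset.mem_insert_self _ _)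
        (by rintro rfl; exact hv huQ))
      exact D.isTree.mem_of_nearest (D.connected u) (D.connected v) (hx huQ) hy hmin hzu hzv

end Lower

/-- A tree given by a parent map `parent` towards the root, which is its own parent, and carrying
bags with at most `b` vertices. The nodes whose bag contains a given vertex form a subtree, since
all of them but one have their parents among them; `depth` rules out cycles. -/
structure RootedDecomposition {V : Type*} (G : SimpleGraph V) (ι : Type) (b : ℕ) where
  root : ι
  parent : ι → ι
  depth : ι → ℕ
  bag : ι → Finset V
  depth_parent : ∀ x, x ≠ root → depth (parent x) < depth x
  parent_root : parent root = root
  edge_mem : ∀ v w, G.Adj v w → ∃ x, v ∈ bag x ∧ w ∈ bag x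
  exists_top : ∀ v, ∃ a, v ∈ bag a ∧ ∀ x, v ∈ bag x → x ≠ a → x ≠ root ∧ v ∈ bag (parent x)
  card_bag_le : ∀ x, (bag x).card ≤ b

namespace RootedDecomposition

variable {V : Type*} {G : SimpleGraph V} {ι : Type} {b : ℕ}

/-- The graph joining every node other than the root to its parent. -/
def tree (D : RootedDecomposition G ι b) : SimpleGraph ι where
  Adj x y := (x ≠ D.root ∧ D.parent x = y) ∨ (y ≠ D.root ∧ D.parent y = x)
  symm := ⟨fun _ _ h => h.symm⟩
  loopless := ⟨fun x h => by
    have h : x ≠ D.root ∧ D.parent x = x := h.elim id id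
    have := D.depth_parent x h.1
    rw [h.2] at this
    exact lt_irrefl _ this⟩

lemma parent_adj (D : RootedDecomposition G ι b) {x : ι} (hx : x ≠ D.root) :
    D.tree.Adj x (D.parent x) := Or.inl ⟨hx, rfl⟩

/-- A set of nodes is connected if it contains the parents of all its nodes except one. -/
lemma connected_induce (D : RootedDecomposition G ι b) {A : Set ι} {a : ι} (ha : a ∈ A)
    (h : ∀ x ∈ A, x ≠ a → x ≠ D.root ∧ D.parent x ∈ A) : (D.tree.induce A).Connected := by
  have key : ∀ d, ∀ x, D.depth x = d → ∀ hx : x ∈ A, (D.tree.induce A).Reachable ⟨x, hx⟩ ⟨a, ha⟩ := by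
    intro d
    induction d using Nat.strong_induction_on with
    | _ d ih =>
      intro x hd hx
      by_cases hxa : x = a
      · subst hxa; rfl
      · obtain ⟨h1, h2⟩ := h x hx hxa
        refine SimpleGraph.Reachable.trans (SimpleGraph.Adj.reachable (v := ⟨D.parent x, h2⟩) ?_)
          (ih _ (hd ▸ D.depth_parent x h1) _ rfl h2)
        exact D.parent_adj h1
  have : Nonempty A := ⟨⟨a, ha⟩⟩
  exact ⟨fun x y => (key _ x.1 rfl x.2).trans (key _ y.1 rfl y.2).symm⟩

lemma isTree_tree [Finite ι] (D : RootedDecomposition G ι b) : D.tree.IsTree := by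
  classical
  have := Fintype.ofFinite ι
  have hconn : D.tree.Connected := by
    have h := D.connected_induce (A := Set.univ) (a := D.root) (Set.mem_univ _)
      fun x _ hx => ⟨hx, Set.mem_univ _⟩
    exact (SimpleGraph.induceUnivIso D.tree).connected_iff.1 h
  refine SimpleGraph.isTree_iff_connected_and_card.2 ⟨hconn, le_antisymm ?_
    hconn.card_vert_le_card_edgeSet_add_one⟩
  have hsub : D.tree.edgeSet ⊆
      (fun x => s(x, D.parent x)) '' ((Finset.univ.erase D.root : Finset ι) : Set ι) := by
    intro e
    induction e using Sym2.ind with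
    | _ x y =>
      rw [SimpleGraph.mem_edgeSet]
      rintro (⟨h, rfl⟩ | ⟨h, rfl⟩)
      · exact ⟨x, by simpa using h, rfl⟩
      · exact ⟨y, by simpa using h, Sym2.eq_swap⟩
  have h1 := Set.ncard_le_ncard hsub (Set.toFinite _)
  have h2 := h1.trans (Set.ncard_image_le (Set.toFinite _))
  rw [Set.ncard_coe_finset, Finset.card_erase_of_mem (Finset.mem_univ _), Finset.card_univ,
    ← Nat.card_eq_fintype_card] at h2
  have h3 : 0 < Nat.card ι := Nat.card_pos_iff.2 ⟨⟨D.root⟩, inferInstance⟩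
  have h4 : Nat.card D.tree.edgeSet = D.tree.edgeSet.ncard := rfl
  omega

/-- The tree-decomposition underlying a rooted one. -/
def toTreeDecomposition [Finite ι] (D : RootedDecomposition G ι b) : TreeDecomposition G D.tree where
  isTree := D.isTree_tree
  bag := D.bag
  edge_mem := D.edge_mem
  connected v := by
    obtain ⟨a, ha, h⟩ := D.exists_top v
    exact D.connected_induce ha h

lemma width_le [Fintype ι] (D : RootedDecomposition G ι b) : D.toTreeDecomposition.width ≤ b - 1 :=
  Nat.sub_le_sub_right (Finset.sup_le fun x _ => D.card_bag_le x) 1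

/-- The fan has a decomposition along its path, with the bags `{none, x, x - 1}`; for
`x = 0` truncated subtraction makes this `{none, 0}`. -/
def fan (m : ℕ) [NeZero m] : RootedDecomposition (fanGraph m) (Fin m) 3 where
  root := 0
  parent x := ⟨x.val - 1, (Nat.sub_le _ _).trans_lt x.2⟩
  depth x := x.val
  bag x := {none, some x, some ⟨x.val - 1, (Nat.sub_le _ _).trans_lt x.2⟩}
  depth_parent x hx := by
    have : x.val ≠ 0 := fun h => hx (Fin.ext (by simpa using h))
    simp only
    omega
  parent_root := by ext; simp
  edge_mem := by
    rintro (_ | u) (_ | v) h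
    · exact h.elim
    · exact ⟨v, by simp⟩
    · exact ⟨u, by simp⟩
    · rcases SimpleGraph.pathGraph_adj.1 h with h | h
      · exact ⟨v, by simp [Fin.ext_iff]; omega⟩
      · exact ⟨u, by simp [Fin.ext_iff]; omega⟩
  exists_top := by
    rintro (_ | u)
    · exact ⟨0, by simp, fun x _ hx => ⟨hx, by simp⟩⟩
    · refine ⟨u, by simp, fun x hx hxu => ?_⟩
      have hne : x.val ≠ u.val := fun h => hxu (Fin.ext h)
      simp only [Finset.mem_insert, reduceCtorEq, Option.some.injEq, false_or,
        Finset.mem_singleton, Fin.ext_iff] at hx ⊢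
      refine ⟨fun h => ?_, Or.inl (by omega)⟩
      have : x.val = 0 := by rw [h]; rfl
      omega
  card_bag_le x := Finset.card_le_three

open Classical in
/-- A decomposition of a cone: a new root with the apex as its bag, joined to the roots of the
decompositions of the copies, to whose bags the apex is added. -/
noncomputable def cone (m : ℕ) (D : RootedDecomposition G ι b) :
    RootedDecomposition (coneGraph m G) (Option (Fin m × ι)) (b + 1) where
  root := none
  parent x := x.elim none fun p => if p.2 = D.root then none else some (p.1, D.parent p.2)
  depth x := x.elim 0 fun p => D.depth p.2 + 1
  bag x := x.elim {none} fun p => insert none ((D.bag p.2).image fun v => some (p.1, v))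
  depth_parent := by
    rintro (_ | ⟨i, x⟩) h
    · exact absurd rfl h
    · by_cases hx : x = D.root
      · simp [hx]
      · simpa [hx] using D.depth_parent x hx
  parent_root := rfl
  edge_mem := by
    rintro (_ | ⟨i, u⟩) (_ | ⟨j, v⟩) h
    · exact h.elim
    · obtain ⟨a, ha, -⟩ := D.exists_top v
      exact ⟨some (j, a), by simpa using ha⟩
    · obtain ⟨a, ha, -⟩ := D.exists_top u
      exact ⟨some (i, a), by simpa using ha⟩
    · obtain ⟨rfl, h⟩ := h
      obtain ⟨x, hx⟩ := D.edge_mem u v h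
      exact ⟨some (i, x), by simpa using hx⟩
  exists_top := by
    rintro (_ | ⟨i, v⟩)
    · refine ⟨none, by simp, ?_⟩
      rintro (_ | ⟨i, x⟩) - hx
      · exact absurd rfl hx
      · refine ⟨hx, ?_⟩
        by_cases h : x = D.root <;> simp [h]
    · obtain ⟨a, ha, hD⟩ := D.exists_top v
      refine ⟨some (i, a), by simpa using ha, ?_⟩
      rintro (_ | ⟨j, x⟩) hx hne
      · simp at hx
      · simp only [Option.elim, Finset.mem_insert, reduceCtorEq, Finset.mem_image,
          Option.some.injEq, Prod.mk.injEq, false_or] at hx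
        obtain ⟨w, hw, rfl, rfl⟩ := hx
        obtain ⟨h1, h2⟩ := hD x hw (by rintro rfl; exact hne rfl)
        refine ⟨by simp, ?_⟩
        simpa [h1] using h2
  card_bag_le := by
    rintro (_ | ⟨i, x⟩)
    · simp
    · exact (Finset.card_insert_le _ _).trans
        (Nat.succ_le_succ (Finset.card_image_le.trans (D.card_bag_le x)))

end RootedDecomposition

lemma exists_rootedDecomposition_iteratedCone {n : ℕ} (hn : 0 < n) (k j : ℕ) :
    ∃ (ι : Type) (_ : Fintype ι), Nonempty (RootedDecomposition (iteratedCone n k j) ι (j + 4)) := by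
  induction j with
  | zero =>
    have : NeZero (n ^ 4) := ⟨by positivity⟩
    exact ⟨Option (Fin (n ^ 2) × Fin (n ^ 4)), inferInstance, ⟨(RootedDecomposition.fan _).cone _⟩⟩
  | succ j ih =>
    obtain ⟨ι, _, ⟨D⟩⟩ := ih
    exact ⟨Option (Fin (k - 1) × ι), inferInstance, ⟨D.cone _⟩⟩

lemma exists_clique_coneGraph {V : Type*} {G : SimpleGraph V} {m s : ℕ} (hm : 0 < m)
    (h : ∃ Q : Finset V, Q.card = s ∧ ∀ u ∈ Q, ∀ v ∈ Q, u ≠ v → G.Adj u v) :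
    ∃ Q : Finset (Option (Fin m × V)), Q.card = s + 1 ∧
      ∀ u ∈ Q, ∀ v ∈ Q, u ≠ v → (coneGraph m G).Adj u v := by
  obtain ⟨Q, hs, hQ⟩ := h
  let i : Fin m := ⟨0, hm⟩
  refine ⟨Finset.insertNone (Q.map ⟨fun v => (i, v), fun u v h => by simpa using h⟩), by simp [hs], ?_⟩
  rintro (_ | ⟨a, u⟩) hu (_ | ⟨b, v⟩) hv hne
  · exact absurd rfl hne
  · trivial
  · trivial
  · rw [Finset.some_mem_insertNone, Finset.mem_map] at hu hv
    obtain ⟨u, hu, ⟨⟩⟩ := hu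
    obtain ⟨v, hv, ⟨⟩⟩ := hv
    exact ⟨rfl, hQ u hu v hv fun h => hne (by rw [h])⟩

lemma exists_clique_iteratedCone {n k : ℕ} (hn : 2 ≤ n) (hk : 2 ≤ k) (j : ℕ) :
    ∃ Q : Finset (IteratedConeVertex n k j), Q.card = j + 4 ∧
      ∀ u ∈ Q, ∀ v ∈ Q, u ≠ v → (iteratedCone n k j).Adj u v := by
  induction j with
  | zero =>
    refine exists_clique_coneGraph (s := 3) (by positivity) ?_
    have h1 : 1 < n ^ 4 := Nat.one_lt_pow (by norm_num) (by omega)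
    let u : Fin (n ^ 4) := ⟨0, by omega⟩
    let v : Fin (n ^ 4) := ⟨1, h1⟩
    have huv : (SimpleGraph.pathGraph (n ^ 4)).Adj u v := SimpleGraph.pathGraph_adj.2 (Or.inl rfl)
    refine ⟨{none, some u, some v}, ?_, ?_⟩
    · exact Finset.card_eq_three.2 ⟨_, _, _, by simp, by simp, by simpa using huv.ne, rfl⟩
    · intro x hx y hy hne
      simp only [Finset.mem_insert, Finset.mem_singleton] at hx hy
      rcases hx with rfl | rfl | rfl <;> rcases hy with rfl | rfl | rfl
      all_goals first
        | exact absurd rfl hne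
        | trivial
        | exact huv
        | exact huv.symm
  | succ j ih => exact exists_clique_coneGraph (by omega) ih

/-- The iterated cone has a clique on `j + 4` vertices and a decomposition into bags of that
size. -/
lemma treewidth_iteratedCone {n k : ℕ} (hn : 2 ≤ n) (hk : 2 ≤ k) (j : ℕ) :
    treewidth (iteratedCone n k j) = j + 3 := by
  obtain ⟨ι, _, ⟨D⟩⟩ := exists_rootedDecomposition_iteratedCone (by omega : 0 < n) k j
  have hmem : D.toTreeDecomposition.width ∈ {w | ∃ (ι : Type) (_ : Fintype ι) (T : SimpleGraph ι)
      (D : TreeDecomposition (iteratedCone n k j) T), D.width = w} :=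
    ⟨ι, inferInstance, _, _, rfl⟩
  apply le_antisymm
  · exact (Nat.sInf_le hmem).trans D.width_le
  · obtain ⟨κ, _, T, E, hE⟩ := Nat.sInf_mem ⟨_, hmem⟩
    unfold treewidth
    rw [← hE]
    obtain ⟨Q, hQ, hadj⟩ := exists_clique_iteratedCone hn hk j
    obtain ⟨x, hx⟩ := E.exists_clique_subset_bag Q hadj
    have h1 := Finset.card_le_card hx
    have h2 : (E.bag x).card ≤ Finset.univ.sup fun x => (E.bag x).card :=
      Finset.le_sup (f := fun x => (E.bag x).card) (Finset.mem_univ x)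
    unfold TreeDecomposition.width
    omega

/-! ### Numbers of vertices and the final estimate -/

lemma card_iteratedConeVertex_zero (n k : ℕ) :
    Fintype.card (IteratedConeVertex n k 0) = n ^ 6 + n ^ 2 + 1 := by
  have : Fintype.card (IteratedConeVertex n k 0) =
    Fintype.card (Option (Fin (n ^ 2) × Option (Fin (n ^ 4)))) := rfl
  rw [this, Fintype.card_option, Fintype.card_prod, Fintype.card_option, Fintype.card_fin,
    Fintype.card_fin]
  ring

lemma card_iteratedConeVertex_succ (n k j : ℕ) :
    Fintype.card (IteratedConeVertex n k (j + 1)) =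
      (k - 1) * Fintype.card (IteratedConeVertex n k j) + 1 := by
  have : Fintype.card (IteratedConeVertex n k (j + 1)) =
    Fintype.card (Option (Fin (k - 1) × IteratedConeVertex n k j)) := rfl
  rw [this, Fintype.card_option, Fintype.card_prod, Fintype.card_fin]

lemma card_iteratedConeVertex_succ_le {n k : ℕ} (hn : 10 ≤ n) (hk : 1 ≤ k) (hkn : 2 * k < n ^ 3)
    (j : ℕ) : Fintype.card (IteratedConeVertex n k (j + 1)) ≤ n ^ 6 * k ^ (j + 1) := by
  obtain ⟨m, rfl⟩ : ∃ m, k = m + 1 := ⟨k - 1, by omega⟩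
  induction j with
  | zero =>
    rw [card_iteratedConeVertex_succ, card_iteratedConeVertex_zero, Nat.add_sub_cancel, zero_add,
      pow_one]
    have h1 : m * (n ^ 2 + 1) + 1 ≤ n ^ 6 := by
      have h2 : m ≤ n ^ 3 := by omega
      have h3 : n ^ 2 + 2 ≤ n ^ 3 := by nlinarith
      have h4 : 0 < n ^ 3 := by positivity
      calc m * (n ^ 2 + 1) + 1 ≤ n ^ 3 * (n ^ 2 + 1) + n ^ 3 := by gcongr; omega
        _ = n ^ 3 * (n ^ 2 + 2) := by ring
        _ ≤ n ^ 3 * n ^ 3 := by gcongr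
        _ = n ^ 6 := by ring
    nlinarith
  | succ j ih =>
    rw [card_iteratedConeVertex_succ, Nat.add_sub_cancel]
    have h1 : 1 ≤ n ^ 6 * (m + 1) ^ (j + 1) := Nat.succ_le_of_lt (by positivity)
    calc m * Fintype.card (IteratedConeVertex n (m + 1) (j + 1)) + 1
        ≤ m * (n ^ 6 * (m + 1) ^ (j + 1)) + n ^ 6 * (m + 1) ^ (j + 1) := by gcongr
      _ = n ^ 6 * (m + 1) ^ (j + 1 + 1) := by ring

lemma le_card_iteratedConeVertex {n k : ℕ} (hk : 2 ≤ k) (j : ℕ) :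
    n ≤ Fintype.card (IteratedConeVertex n k j) := by
  induction j with
  | zero =>
    rw [card_iteratedConeVertex_zero]
    nlinarith [Nat.zero_le (n ^ 6)]
  | succ j ih =>
    rw [card_iteratedConeVertex_succ]
    have := Nat.le_mul_of_pos_left (Fintype.card (IteratedConeVertex n k j))
      (show 0 < k - 1 by omega)
    omega

/-- The largest value of `K` allowed in `hasCluster_iteratedCone_strongProduct` yields the bound,
with real exponents cleared. -/
lemma pow_mul_card_pow_le {n k : ℕ} (hn : 10 ≤ n) (hk : 3 ≤ k) (hkn : 2 * k < n ^ 3) (j : ℕ) :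
    k ^ 7 * (Fintype.card (IteratedConeVertex n k j) * n) ^ 3 ≤
      n ^ 21 * (if j = 0 then k + 1 else k) ^ (3 * j + 7) := by
  rcases j with _ | j
  · rw [card_iteratedConeVertex_zero, if_pos rfl]
    -- The lower-order terms of the number of vertices cost a factor `1 + 1 / k` at most.
    have h1 : k * (n ^ 6 + n ^ 2 + 1) ≤ n ^ 6 * (k + 1) := by
      have h2 : k ≤ n ^ 3 := by omega
      have h3 : n ^ 2 + 1 ≤ n ^ 3 := by nlinarith
      have h4 : k * (n ^ 2 + 1) ≤ n ^ 3 * n ^ 3 := Nat.mul_le_mul h2 h3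
      nlinarith
    calc k ^ 7 * ((n ^ 6 + n ^ 2 + 1) * n) ^ 3
        = k ^ 4 * (k * (n ^ 6 + n ^ 2 + 1) * n) ^ 3 := by ring
      _ ≤ (k + 1) ^ 4 * (n ^ 6 * (k + 1) * n) ^ 3 := by gcongr; omega
      _ = _ := by ring
  · rw [if_neg (by omega)]
    calc k ^ 7 * (Fintype.card (IteratedConeVertex n k (j + 1)) * n) ^ 3
        ≤ k ^ 7 * (n ^ 6 * k ^ (j + 1) * n) ^ 3 := by
          gcongr; exact card_iteratedConeVertex_succ_le hn (by omega) hkn j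
      _ = _ := by ring

lemma if_le_clustering {n k : ℕ} (hn : 10 ≤ n) (hk : 3 ≤ k) (hkn : 2 * k < n ^ 3) (j : ℕ)
    (f : IteratedConeVertex n k j × Fin n → Fin (j + 3)) :
    (if j = 0 then k + 1 else k) ≤
      clustering (strongProduct (iteratedCone n k j) (SimpleGraph.pathGraph n)) f := by
  split_ifs with hj
  · exact (hasCluster_iteratedCone_strongProduct hn hkn j (Or.inl hj) f Finset.univ (by simp)
      fun _ => Finset.mem_univ _).le_clustering
  · have h := (hasCluster_iteratedCone_strongProduct (K := k - 1) hn (by omega) j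
      (Or.inr le_rfl) f Finset.univ (by simp) fun _ => Finset.mem_univ _).le_clustering
    omega

lemma rpow_mul_card_rpow_le_clustering {n k c j : ℕ} (hn : 10 ≤ n) (hk : 3 ≤ k) (hc : c = j + 3)
    (hkn : 2 * k < n ^ 3) {δ : ℝ} (hδ : (k : ℝ) = δ * (n : ℝ) ^ 3)
    (f : IteratedConeVertex n k j × Fin n → Fin c) :
    δ ^ (7 / (3 * (c : ℝ) - 2)) *
        (Fintype.card (IteratedConeVertex n k j × Fin n) : ℝ) ^
          (1 / ((c : ℝ) - 2 / 3)) ≤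
      (clustering (strongProduct (iteratedCone n k j) (SimpleGraph.pathGraph n)) f : ℝ) := by
  subst hc
  have hn0 : (0 : ℝ) < n := by exact_mod_cast (by omega : 0 < n)
  have hk0 : (0 : ℝ) < k := by exact_mod_cast (by omega : 0 < k)
  have hδ' : δ = k / (n : ℝ) ^ 3 := by rw [hδ]; field_simp
  have hδ0 : 0 < δ := by rw [hδ']; positivity
  set N := Fintype.card (IteratedConeVertex n k j × Fin n) with hN
  have hNeq : N = Fintype.card (IteratedConeVertex n k j) * n := by
    rw [hN, Fintype.card_prod, Fintype.card_fin]
  set X := if j = 0 then k + 1 else k with hX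
  refine le_trans ?_ (Nat.cast_le.2 (if_le_clustering hn hk hkn j f))
  rw [← hX]
  set e : ℕ := 3 * j + 7 with he
  have he1 : 3 * ((j + 3 : ℕ) : ℝ) - 2 = (e : ℝ) := by rw [he]; push_cast; ring
  have he0 : (0 : ℝ) < e := by rw [he]; positivity
  have he2 : 1 / (((j + 3 : ℕ) : ℝ) - 2 / 3) = 3 * (e : ℝ)⁻¹ := by
    rw [← he1]
    have h3 : (((j + 3 : ℕ) : ℝ) - 2 / 3) = (e : ℝ) / 3 := by rw [← he1]; ring
    rw [h3, he1]
    field_simp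
  rw [he1, he2, div_eq_mul_inv, Real.rpow_mul hδ0.le, Real.rpow_mul (Nat.cast_nonneg N),
    ← Real.mul_rpow (by positivity) (by positivity)]
  have h7 : δ ^ (7 : ℝ) = δ ^ 7 := by exact_mod_cast Real.rpow_natCast δ 7
  have h3 : (N : ℝ) ^ (3 : ℝ) = (N : ℝ) ^ 3 := by exact_mod_cast Real.rpow_natCast (N : ℝ) 3
  rw [h7, h3]
  have hmain : δ ^ 7 * (N : ℝ) ^ 3 ≤ (X : ℝ) ^ e := by
    have hnat := pow_mul_card_pow_le hn hk hkn j
    rw [← hNeq, ← hX, ← he] at hnat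
    have hreal : (k : ℝ) ^ 7 * (N : ℝ) ^ 3 ≤ (n : ℝ) ^ 21 * (X : ℝ) ^ e := by exact_mod_cast hnat
    rw [hδ', div_pow, div_mul_eq_mul_div, div_le_iff₀ (by positivity)]
    calc (k : ℝ) ^ 7 * (N : ℝ) ^ 3 ≤ (n : ℝ) ^ 21 * (X : ℝ) ^ e := hreal
      _ = (X : ℝ) ^ e * ((n : ℝ) ^ 3) ^ 7 := by ring
  calc (δ ^ 7 * (N : ℝ) ^ 3) ^ (e : ℝ)⁻¹ ≤ ((X : ℝ) ^ e) ^ (e : ℝ)⁻¹ :=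
        Real.rpow_le_rpow (by positivity) hmain (by positivity)
    _ = X := Real.pow_rpow_inv_natCast (Nat.cast_nonneg X) (by omega)

theorem mainTheorem5 :
    (∀ c : ℕ, 3 ≤ c → ∃ ε : ℝ, 0 < ε ∧ ∀ N : ℕ, ∃ n k : ℕ,
      N ≤ n ∧ 3 ≤ k ∧ 2 * k < n ^ 3 ∧
      N ≤ Fintype.card (IteratedConeVertex n k (c - 3)) ∧
      treewidth (iteratedCone n k (c - 3)) = c ∧
      ∀ f : IteratedConeVertex n k (c - 3) × Fin n → Fin c,
        ε * (Fintype.card (IteratedConeVertex n k (c - 3) × Fin n) : ℝ) ^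
            (1 / ((c : ℝ) - 2 / 3)) ≤
          (clustering (strongProduct (iteratedCone n k (c - 3)) (SimpleGraph.pathGraph n)) f : ℝ)) ∧
    (∃ n₀ : ℕ, ∀ n : ℕ, n₀ ≤ n → ∀ k c : ℕ, 3 ≤ k → 3 ≤ c → 2 * k < n ^ 3 →
      ∀ δ : ℝ, δ < 1 / 2 → (k : ℝ) = δ * (n : ℝ) ^ 3 →
      treewidth (iteratedCone n k (c - 3)) = c ∧
      ∀ f : IteratedConeVertex n k (c - 3) × Fin n → Fin c,
        δ ^ (7 / (3 * (c : ℝ) - 2)) *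
            (Fintype.card (IteratedConeVertex n k (c - 3) × Fin n) : ℝ) ^
              (1 / ((c : ℝ) - 2 / 3)) ≤
          (clustering (strongProduct (iteratedCone n k (c - 3)) (SimpleGraph.pathGraph n)) f : ℝ)) := by
  have htw : ∀ n k c : ℕ, 10 ≤ n → 3 ≤ k → 3 ≤ c → treewidth (iteratedCone n k (c - 3)) = c := by
    intro n k c hn hk hc
    rw [treewidth_iteratedCone (by omega) (by omega)]
    omega
  refine ⟨fun c hc => ⟨(1 / 4 : ℝ) ^ (7 / (3 * (c : ℝ) - 2)), by positivity, fun N => ?_⟩,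
    10, fun n hn k c hk hc hkn δ _ hδ =>
      ⟨htw n k c hn hk hc, rpow_mul_card_rpow_le_clustering hn hk (by omega) hkn hδ⟩⟩
  -- Taking `k` as large as allowed keeps `δ` above `1 / 4`.
  set n := max N 10 with hn
  have hn10 : 10 ≤ n := le_max_right _ _
  have hn3 : 10 ^ 3 ≤ n ^ 3 := Nat.pow_le_pow_left hn10 3
  set k := (n ^ 3 - 1) / 2 with hk
  have hk3 : 3 ≤ k := by omega
  have hkn : 2 * k < n ^ 3 := by omega
  have hkn' : n ^ 3 ≤ 4 * k := by omega
  refine ⟨n, k, le_max_left _ _, hk3, hkn,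
    (le_max_left _ _).trans (le_card_iteratedConeVertex (by omega) _), htw n k c hn10 hk3 hc,
    fun f => ?_⟩
  have hnpos : (0 : ℝ) < (n : ℝ) ^ 3 := by
    have : (0 : ℝ) < n := by exact_mod_cast (by omega : 0 < n)
    positivity
  have hδ : (1 / 4 : ℝ) ≤ k / (n : ℝ) ^ 3 := by
    rw [le_div_iff₀ hnpos]
    have : ((n : ℝ)) ^ 3 ≤ 4 * k := by exact_mod_cast hkn'
    linarith
  have hc3 : (3 : ℝ) ≤ c := by exact_mod_cast hc
  have hexp : 0 ≤ 7 / (3 * (c : ℝ) - 2) := div_nonneg (by norm_num) (by linarith)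
  refine le_trans (mul_le_mul_of_nonneg_right (Real.rpow_le_rpow (by norm_num) hδ hexp)
    (by positivity)) (rpow_mul_card_rpow_le_clustering hn10 hk3 (by omega) hkn ?_ f)
  field_simp
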